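/- Fix $d$ items and, for $w\in\mathbb R^d$, let the Plackett--Luce model with quality parameters $w$ give a ranking of a set $\Omega\subseteq[d]$ the probability $\mathbb P(i_1\succ i_2\succ\cdots\succ i_m)=\prod_{j=1}^m \frac{\exp(w_{i_j})}{\sum_{j'=j}^m \exp(w_{i_{j'}})}$, where $\Omega=\{i_1,\dots,i_m\}$; its pairwise probability matrix has the entries $\mathbb P(i\succ j)=\frac{\exp(w_i)}{\exp(w_i)+\exp(w_j)}$. Let $P$ and $Q$ be the pairwise probability matrices of two such populations, with parameters $w^P,w^Q\in\mathbb R^d$. For some $m\in\{2,\dots,d-1\}$ we observe $N$ independent samples from each population, each of which is a Plackett--Luce ranking of $m$ items chosen uniformly at random from the $d$ items. Consider the following test. Random disjoint rank breaking: break every ranking, independently and uniformly at random, into $\lfloor m/2\rfloor$ pairwise comparisons such that no item is in more than one of them. For $i<j$ let $k^p_{ij}$ and $k^q_{ij}$ be the resulting numbers of comparisons of $i$ and $j$ in the two populations, and $X_{ij}$ and $Y_{ij}$ the numbers of those that $i$ wins. Reject the null hypothesis $P=Q$ if and only if $T\ge 11d$, where $$T=\sum_{i<j}\mathbb 1(k^p_{ij}>1)\,\mathbb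 1(k^q_{ij}>1)\,\frac{k^q_{ij}(k^q_{ij}-1)(X_{ij}^2-X_{ij})+k^p_{ij}(k^p_{ij}-1)(Y_{ij}^2-Y_{ij})-2(k^p_{ij}-1)(k^q_{ij}-1)X_{ij}Y_{ij}}{(k^p_{ij}-1)(k^q_{ij}-1)(k^p_{ij}+k^q_{ij})}.$$ Theorem. There is a constant $c_0>0$ such that for all constants $c_1,c_2>0$ there is a constant $c>0$ (depending on $c_1,c_2$ only) with the following property. For all $d$, all $m\in\{2,\dots,d-1\}$, all $N$ and all $\epsilon$, if $$N\ \ge\ c\,\frac{d^2\log d}{m}\left\lceil\frac{c_0}{d\epsilon^2}\right\rceil\qquad\text{and}\qquad \epsilon\ge c_1d^{-c_2},$$ then this test correctly distinguishes between $P=Q$ and $\frac1d\|P-Q\|_F\ge\epsilon$ with probability at least $\frac23$: the sum of its worst-case Type I error (the supremum, over all $w^P,w^Q$ with $P=Q$, of the probability of rejecting) and its worst-case Type II error (the supremum, over all $w^P,w^Q$ with $\frac1d\|P-Q\|_F\ge\epsilon$, of the probability of not rejecting) is at most $\frac13$. -/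

import Mathlib

namespace RankTest

noncomputable section

open Finset
open scoped ENNReal Matrix.Norms.Frobenius

/-! ### The Plackett–Luce model

Items are the elements of `Fin d`.  A partial ranking of length `m` is an injection
`τ : Fin m ↪ Fin d`; `τ 0` is the top-ranked item, `τ 1` the second one, and so on, and the set of
ranked items is the image `univ.map τ`. -/

/-- The Plackett–Luce probability of the ranking `τ 0 ≻ τ 1 ≻ ⋯ ≻ τ (m - 1)` of its own items,
`∏ j, exp (w (τ j)) / ∑ j' ≥ j, exp (w (τ j'))`. -/
def plWeight {d m : ℕ} (w : Fin d → ℝ) (τ : Fin m ↪ Fin d) : ℝ :=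
  ∏ j : Fin m, Real.exp (w (τ j)) / ∑ j' ∈ Finset.Ici j, Real.exp (w (τ j'))

theorem plWeight_nonneg {d m : ℕ} (w : Fin d → ℝ) (τ : Fin m ↪ Fin d) : 0 ≤ plWeight w τ :=
  Finset.prod_nonneg fun _ _ =>
    div_nonneg (Real.exp_pos _).le (Finset.sum_nonneg fun _ _ => (Real.exp_pos _).le)

theorem sum_plWeight {d : ℕ} (w : Fin d → ℝ) (m : ℕ) (S : Finset (Fin d)) (hS : #S = m) :
    ∑ τ : Fin m ↪ Fin d, (if univ.map τ = S then plWeight w τ else 0) = 1 := by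
  induction m generalizing S with
  | zero =>
    have h : S = ∅ := Finset.card_eq_zero.mp hS
    subst h
    simp [plWeight]
  | succ m ih =>
    have hpos : 0 < ∑ k ∈ S, Real.exp (w k) :=
      Finset.sum_pos (fun _ _ => Real.exp_pos _) (Finset.card_pos.mp (by omega))
    have key : ∀ (e : Fin m ↪ Fin d) (i : {i // i ∉ Set.range e}),
        (if univ.map ((Equiv.embeddingFinSucc m (Fin d)).symm ⟨e, i⟩) = S
          then plWeight w ((Equiv.embeddingFinSucc m (Fin d)).symm ⟨e, i⟩) else 0)
        = if univ.map e = S.erase i.1 ∧ i.1 ∈ S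
          then Real.exp (w i.1) / (∑ k ∈ S, Real.exp (w k)) * plWeight w e else 0 := by
      intro e i
      set τ := (Equiv.embeddingFinSucc m (Fin d)).symm ⟨e, i⟩ with hτ
      have h0 : τ 0 = i.1 := by simp [hτ]
      have hs : ∀ k : Fin m, τ k.succ = e k := by intro k; simp [hτ]
      have hi : i.1 ∉ univ.map e := by
        have := i.2
        simpa using this
      have hmap : univ.map τ = insert i.1 (univ.map e) := by
        ext x
        simp only [Finset.mem_map, Finset.mem_univ, true_and, Finset.mem_insert, Fin.exists_fin_succ,
          h0, hs]
        exact or_congr_left eq_comm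
      have hiff : univ.map τ = S ↔ univ.map e = S.erase i.1 ∧ i.1 ∈ S := by
        rw [hmap]
        constructor
        · intro h
          rw [← h]
          exact ⟨(Finset.erase_insert hi).symm, Finset.mem_insert_self _ _⟩
        · rintro ⟨h, h'⟩
          rw [h, Finset.insert_erase h']
      by_cases hc : univ.map τ = S
      · rw [if_pos hc, if_pos (hiff.mp hc)]
        unfold plWeight
        rw [Fin.prod_univ_succ]
        congr 1
        · have hI : Finset.Ici (0 : Fin (m + 1)) = univ := by
            ext j
            simp
          rw [h0, ← hc, Finset.sum_map, hI]
        · refine Finset.prod_congr rfl fun j _ => ?_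
          rw [hs, ← Fin.map_succEmb_Ici, Finset.sum_map]
          simp [hs]
      · rw [if_neg hc, if_neg (fun h => hc (hiff.mpr h))]
    rw [← (Equiv.embeddingFinSucc m (Fin d)).symm.sum_comp, Fintype.sum_sigma]
    simp_rw [key]
    have key2 : ∀ e : Fin m ↪ Fin d,
        (∑ i : {i // i ∉ Set.range e}, if univ.map e = S.erase i.1 ∧ i.1 ∈ S
          then Real.exp (w i.1) / (∑ k ∈ S, Real.exp (w k)) * plWeight w e else 0)
        = ∑ i ∈ S, Real.exp (w i) / (∑ k ∈ S, Real.exp (w k))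
            * (if univ.map e = S.erase i then plWeight w e else 0) := by
      intro e
      rw [← Finset.sum_subtype (Finset.univ.filter fun i => i ∉ Set.range e) (by simp)
        (fun i => if univ.map e = S.erase i ∧ i ∈ S
          then Real.exp (w i) / (∑ k ∈ S, Real.exp (w k)) * plWeight w e else 0)]
      rw [Finset.sum_filter, ← Finset.sum_subset (Finset.subset_univ S)]
      · refine Finset.sum_congr rfl fun i hi => ?_
        by_cases h : univ.map e = S.erase i
        · have hr : i ∉ Set.range e := by
            have : i ∉ univ.map e := by rw [h]; simp
            simpa using this
          rw [if_pos hr, if_pos ⟨h, hi⟩, if_pos h]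
        · simp [h]
      · intro i _ hi
        simp [hi]
    simp_rw [key2]
    rw [Finset.sum_comm]
    simp_rw [← Finset.mul_sum]
    calc _ = ∑ i ∈ S, Real.exp (w i) / (∑ k ∈ S, Real.exp (w k)) := by
            refine Finset.sum_congr rfl fun i hi => ?_
            rw [ih (S.erase i) (by rw [Finset.card_erase_of_mem hi]; omega), mul_one]
      _ = 1 := by rw [← Finset.sum_div, div_self hpos.ne']

/-- The Plackett–Luce distribution on the rankings of the set `Ω` of `m` items. -/
def plRanking {d m : ℕ} (w : Fin d → ℝ) (Ω : {S : Finset (Fin d) // #S = m}) :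
    PMF (Fin m ↪ Fin d) :=
  PMF.ofFintype (fun τ => if univ.map τ = Ω.1 then ENNReal.ofReal (plWeight w τ) else 0) (by
    have h := congrArg ENNReal.ofReal (sum_plWeight w m Ω.1 Ω.2)
    rw [ENNReal.ofReal_sum_of_nonneg, ENNReal.ofReal_one] at h
    · rw [← h]
      refine Finset.sum_congr rfl fun τ _ => ?_
      split_ifs <;> simp
    · intro τ _
      split_ifs
      exacts [plWeight_nonneg w τ, le_rfl])

theorem nonempty_subsets {d m : ℕ} (h : m ≤ d) : Nonempty {S : Finset (Fin d) // #S = m} := by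
  obtain ⟨S, -, hS⟩ := Finset.exists_subset_card_eq (s := (univ : Finset (Fin d))) (n := m)
    (by simpa using h)
  exact ⟨⟨S, hS⟩⟩

/-- One sample: `m` items are chosen uniformly at random and then ranked according to the
Plackett–Luce model with quality parameters `w`. -/
def rankingSample {d m : ℕ} (h : m ≤ d) (w : Fin d → ℝ) : PMF (Fin m ↪ Fin d) :=
  haveI := nonempty_subsets h
  (PMF.uniformOfFintype {S : Finset (Fin d) // #S = m}).bind (plRanking w)

/-- The matrix of pairwise marginal probabilities `ℙ(i ≻ j)` of the Plackett–Luce model with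
quality parameters `w`. -/
def pairwiseMatrix {d : ℕ} (w : Fin d → ℝ) : Matrix (Fin d) (Fin d) ℝ :=
  Matrix.of fun i j => Real.exp (w i) / (Real.exp (w i) + Real.exp (w j))

/-! ### Independent draws -/

/-- The joint distribution of independent draws from the distributions `p s`. -/
def indep {ι α : Type} [Fintype ι] [DecidableEq ι] [Fintype α] (p : ι → PMF α) : PMF (ι → α) :=
  PMF.ofFintype (fun x => ∏ s, p s (x s)) (by
    rw [← Fintype.prod_sum]
    refine Finset.prod_eq_one fun s _ => ?_
    rw [← tsum_fintype (L := .unconditional _)]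
    exact (p s).tsum_coe)

/-! ### Random disjoint rank breaking -/

/-- All the ways to break the ranking `τ` of `m` items into `⌊m / 2⌋` pairwise comparisons such
that no item is in more than one of them.  A comparison `(i, j)` records that `i` beat `j`. -/
def disjointBreakings {d m : ℕ} (τ : Fin m ↪ Fin d) : Finset (Finset (Fin d × Fin d)) :=
  {C | #C = m / 2 ∧
    (∀ p ∈ C, ∃ a b : Fin m, a < b ∧ p = (τ a, τ b)) ∧
    (∀ p ∈ C, ∀ q ∈ C, p ≠ q → Disjoint ({p.1, p.2} : Finset (Fin d)) {q.1, q.2})}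

theorem disjointBreakings_nonempty {d m : ℕ} (τ : Fin m ↪ Fin d) :
    (disjointBreakings τ).Nonempty := by
  have hlt : ∀ t : Fin (m / 2), 2 * t.1 < m ∧ 2 * t.1 + 1 < m := fun t => by
    have := t.2
    omega
  let f : Fin (m / 2) → Fin d × Fin d := fun t =>
    (τ ⟨2 * t.1, (hlt t).1⟩, τ ⟨2 * t.1 + 1, (hlt t).2⟩)
  have hf : Function.Injective f := by
    intro s t h
    have h1 := congrArg Fin.val (τ.injective (congrArg Prod.fst h))
    simp only at h1
    exact Fin.ext (by omega)
  refine ⟨univ.image f, ?_⟩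
  simp only [disjointBreakings, Finset.mem_filter, Finset.mem_univ, true_and, Finset.mem_image]
  refine ⟨by simp [Finset.card_image_of_injective _ hf], ?_, ?_⟩
  · rintro p ⟨t, rfl⟩
    exact ⟨_, _, by simp, rfl⟩
  · rintro p ⟨s, rfl⟩ q ⟨t, rfl⟩ hst
    have hne : s.1 ≠ t.1 := fun h => hst (congrArg f (Fin.ext h))
    simp only [f, Finset.disjoint_left, Finset.mem_insert, Finset.mem_singleton, not_or]
    rintro x (rfl | rfl) <;> constructor <;> intro h <;>
      · have h1 := congrArg Fin.val (τ.injective h)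
        simp only at h1
        omega

/-- Random disjoint rank breaking of one ranking: a uniformly random way to break it into
`⌊m / 2⌋` disjoint pairwise comparisons. -/
def randomDisjoint {d m : ℕ} (τ : Fin m ↪ Fin d) : PMF (Finset (Fin d × Fin d)) :=
  PMF.uniformOfFinset (disjointBreakings τ) (disjointBreakings_nonempty τ)

/-! ### The test -/

/-- The number of times item `i` beat item `j` in the comparisons obtained from `N` rankings. -/
def wins {d N : ℕ} (C : Fin N → Finset (Fin d × Fin d)) (i j : Fin d) : ℕ :=
  #{s | (i, j) ∈ C s}

/-- The number of times the items `i` and `j` were compared. -/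
def comparisons {d N : ℕ} (C : Fin N → Finset (Fin d × Fin d)) (i j : Fin d) : ℕ :=
  #{s | (i, j) ∈ C s ∨ (j, i) ∈ C s}

/-- The contribution of one pair of items to the test statistic, where `x` of `k` comparisons were
won in the first population and `y` of `l` comparisons in the second one. -/
def statTerm (k l x y : ℕ) : ℝ :=
  if 1 < k ∧ 1 < l then
    ((l : ℝ) * (l - 1) * ((x : ℝ) ^ 2 - x) + (k : ℝ) * (k - 1) * ((y : ℝ) ^ 2 - y)
        - 2 * ((k : ℝ) - 1) * ((l : ℝ) - 1) * x * y)
      / (((k : ℝ) - 1) * ((l : ℝ) - 1) * ((k : ℝ) + l))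
  else 0

/-- The test statistic `T`, a sum over the pairs `i < j`. -/
def testStatistic {d N : ℕ} (CP CQ : Fin N → Finset (Fin d × Fin d)) : ℝ :=
  ∑ i : Fin d, ∑ j ∈ Finset.Ioi i,
    statTerm (comparisons CP i j) (comparisons CQ i j) (wins CP i j) (wins CQ i j)

open Classical in
/-- The testing algorithm with random disjoint rank breaking, run on the two sets `SP` and `SQ` of
rankings: every ranking is broken independently, and the output is `true` (reject the null
hypothesis) if `T ≥ 11 d`, and `false` otherwise. -/
def algorithm {d m N : ℕ} (SP SQ : Fin N → (Fin m ↪ Fin d)) : PMF Bool :=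
  (indep fun s => randomDisjoint (SP s)).bind fun CP =>
    (indep fun s => randomDisjoint (SQ s)).map fun CQ =>
      decide (11 * (d : ℝ) ≤ testStatistic CP CQ)

/-- The output of the testing algorithm on `N` independent samples from each of the two populations
with quality parameters `wP` and `wQ`. -/
def testOutcome {d m : ℕ} (h : m ≤ d) (N : ℕ) (wP wQ : Fin d → ℝ) : PMF Bool :=
  (indep fun _ : Fin N => rankingSample h wP).bind fun SP =>
    (indep fun _ : Fin N => rankingSample h wQ).bind fun SQ => algorithm SP SQ

/-- The worst-case Type I error: the largest probability of rejecting when `P = Q`. -/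
def typeIError {d m : ℕ} (h : m ≤ d) (N : ℕ) : ℝ≥0∞ :=
  ⨆ (wP : Fin d → ℝ) (wQ : Fin d → ℝ) (_ : pairwiseMatrix wP = pairwiseMatrix wQ),
    testOutcome h N wP wQ true

/-- The worst-case Type II error: the largest probability of not rejecting when
`(1 / d) ‖P - Q‖_F ≥ ε`. -/
def typeIIError {d m : ℕ} (h : m ≤ d) (N : ℕ) (ε : ℝ) : ℝ≥0∞ :=
  ⨆ (wP : Fin d → ℝ) (wQ : Fin d → ℝ)
    (_ : ε ≤ (1 / (d : ℝ)) * ‖pairwiseMatrix wP - pairwiseMatrix wQ‖),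
    testOutcome h N wP wQ false

end

end RankTest

namespace RankTest

open Finset
open scoped ENNReal Matrix.Norms.Frobenius

noncomputable section

/-! ### Expectations under probability mass functions on finite types -/

/-- The expectation of `f` under `p`. -/
def ex {α : Type} [Fintype α] (p : PMF α) (f : α → ℝ) : ℝ := ∑ x, (p x).toReal * f x

section Expectation

variable {α β ι : Type} [Fintype α] [Fintype β] [Fintype ι] [DecidableEq ι]

theorem sum_toReal_eq_one (p : PMF α) : ∑ x, (p x).toReal = 1 := by
  rw [← ENNReal.toReal_sum fun x _ => p.apply_ne_top x, ← tsum_fintype (L := .unconditional _),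
    p.tsum_coe, ENNReal.toReal_one]

theorem ex_const (p : PMF α) (c : ℝ) : ex p (fun _ => c) = c := by
  rw [ex, ← Finset.sum_mul, sum_toReal_eq_one, one_mul]

theorem ex_add (p : PMF α) (f g : α → ℝ) : ex p (fun x => f x + g x) = ex p f + ex p g := by
  simp only [ex, mul_add, Finset.sum_add_distrib]

theorem ex_sub (p : PMF α) (f g : α → ℝ) : ex p (fun x => f x - g x) = ex p f - ex p g := by
  simp only [ex, mul_sub, Finset.sum_sub_distrib]

theorem ex_mul_left (p : PMF α) (c : ℝ) (f : α → ℝ) : ex p (fun x => c * f x) = c * ex p f := by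
  simp only [ex, Finset.mul_sum]
  exact Finset.sum_congr rfl fun x _ => by ring

theorem ex_mul_right (p : PMF α) (c : ℝ) (f : α → ℝ) : ex p (fun x => f x * c) = ex p f * c := by
  simp only [ex, Finset.sum_mul, mul_assoc]

theorem ex_sum {κ : Type} (p : PMF α) (s : Finset κ) (f : κ → α → ℝ) :
    ex p (fun x => ∑ k ∈ s, f k x) = ∑ k ∈ s, ex p (f k) := by
  simp only [ex, Finset.mul_sum]
  exact Finset.sum_comm

theorem ex_mono_of_support (p : PMF α) {f g : α → ℝ} (h : ∀ x, p x ≠ 0 → f x ≤ g x) :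
    ex p f ≤ ex p g := by
  refine Finset.sum_le_sum fun x _ => ?_
  by_cases hx : p x = 0
  · simp [hx]
  · exact mul_le_mul_of_nonneg_left (h x hx) ENNReal.toReal_nonneg

theorem ex_mono (p : PMF α) {f g : α → ℝ} (h : ∀ x, f x ≤ g x) : ex p f ≤ ex p g :=
  ex_mono_of_support p fun x _ => h x

theorem ex_congr_of_support (p : PMF α) {f g : α → ℝ} (h : ∀ x, p x ≠ 0 → f x = g x) :
    ex p f = ex p g :=
  le_antisymm (ex_mono_of_support p fun x hx => (h x hx).le)
    (ex_mono_of_support p fun x hx => (h x hx).ge)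

theorem ex_bind (p : PMF α) (κ : α → PMF β) (f : β → ℝ) :
    ex (p.bind κ) f = ex p fun a => ex (κ a) f := by
  simp only [ex]
  have h : ∀ b, ((p.bind κ) b).toReal = ∑ a, (p a).toReal * (κ a b).toReal := by
    intro b
    rw [PMF.bind_apply, tsum_fintype, ENNReal.toReal_sum]
    · simp
    · exact fun a _ => ENNReal.mul_ne_top (p.apply_ne_top a) ((κ a).apply_ne_top b)
  simp only [h, Finset.sum_mul, Finset.mul_sum]
  rw [Finset.sum_comm]
  simp only [mul_assoc]

theorem ex_pure (a : α) (f : α → ℝ) : ex (PMF.pure a) f = f a := by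
  classical
  rw [ex, Finset.sum_eq_single a]
  · simp
  · intro b _ hb
    simp [hb]
  · simp

theorem ex_map (p : PMF α) (g : α → β) (f : β → ℝ) : ex (p.map g) f = ex p fun a => f (g a) := by
  simp only [PMF.map, ex_bind, Function.comp_apply, ex_pure]

theorem ex_comm (p : PMF α) (q : PMF β) (f : α → β → ℝ) :
    ex p (fun a => ex q (f a)) = ex q fun b => ex p fun a => f a b := by
  simp only [ex, Finset.mul_sum]
  rw [Finset.sum_comm]
  exact Finset.sum_congr rfl fun _ _ => Finset.sum_congr rfl fun _ _ => by ring

theorem ex_markov (p : PMF α) {f : α → ℝ} (hf : ∀ x, 0 ≤ f x) {t : ℝ} (ht : 0 < t) :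
    ex p (fun x => if t ≤ f x then 1 else 0) ≤ ex p f / t := by
  rw [le_div_iff₀ ht, ← ex_mul_right]
  refine ex_mono p fun x => ?_
  split_ifs with h
  · simpa using h
  · simpa using hf x

theorem ex_chebyshev (p : PMF α) (f : α → ℝ) {t : ℝ} (ht : 0 < t) :
    ex p (fun x => if t ≤ |f x| then 1 else 0) ≤ ex p (fun x => f x ^ 2) / t ^ 2 := by
  refine le_trans (ex_mono p fun x => ?_)
    (ex_markov p (f := fun x => f x ^ 2) (fun x => sq_nonneg _) (pow_pos ht 2))
  by_cases h : t ≤ |f x|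
  · have : t ^ 2 ≤ f x ^ 2 := by
      rw [← sq_abs (f x)]
      gcongr
    simp [h, this]
  · rw [if_neg h]
    split_ifs <;> norm_num

/-! ### Independent draws -/

theorem indep_apply (p : ι → PMF α) (x : ι → α) : indep p x = ∏ i, p i (x i) := by
  simp [indep]

theorem indep_bind (p : ι → PMF α) (κ : ι → α → PMF β) :
    indep (fun i => (p i).bind (κ i)) = (indep p).bind fun x => indep fun i => κ i (x i) := by
  ext y
  simp only [indep_apply, PMF.bind_apply, tsum_fintype, ← Finset.prod_mul_distrib]
  exact Fintype.prod_sum fun i a => p i a * κ i a (y i)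

theorem indep_pure (x : ι → α) : indep (fun i => PMF.pure (x i)) = PMF.pure x := by
  classical
  ext y
  rw [indep_apply, PMF.pure_apply]
  split_ifs with h
  · simp [h]
  · obtain ⟨i, hi⟩ := Function.ne_iff.mp h
    exact Finset.prod_eq_zero (Finset.mem_univ i) (by simp [PMF.pure_apply, hi])

theorem indep_map (p : ι → PMF α) (g : ι → α → β) :
    indep (fun i => (p i).map (g i)) = (indep p).map fun x i => g i (x i) := by
  simp only [PMF.map, indep_bind, Function.comp_apply, indep_pure]
  rfl

theorem ex_indep_prod (p : ι → PMF α) (f : ι → α → ℝ) :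
    ex (indep p) (fun x => ∏ i, f i (x i)) = ∏ i, ex (p i) (f i) := by
  simp only [ex, indep_apply, ENNReal.toReal_prod, ← Finset.prod_mul_distrib]
  exact (Fintype.prod_sum fun i a => (p i a).toReal * f i a).symm

theorem ex_indep_apply (p : ι → PMF α) (i : ι) (g : α → ℝ) :
    ex (indep p) (fun x => g (x i)) = ex (p i) g := by
  have h := ex_indep_prod p fun j a => if j = i then g a else 1
  simp only [Finset.prod_ite_eq', Finset.mem_univ, if_true] at h
  rw [h, Finset.prod_eq_single i]
  · simp
  · intro j _ hj
    simp [hj, ex_const]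
  · simp

theorem ex_indep_mul (p : ι → PMF α) {i j : ι} (hij : i ≠ j) (g h : α → ℝ) :
    ex (indep p) (fun x => g (x i) * h (x j)) = ex (p i) g * ex (p j) h := by
  have hp := ex_indep_prod p fun k a => (if k = i then g a else 1) * (if k = j then h a else 1)
  simp only [Finset.prod_mul_distrib, Finset.prod_ite_eq', Finset.mem_univ, if_true] at hp
  rw [hp, Fintype.prod_eq_mul i j hij]
  · simp [hij, hij.symm]
  · rintro k ⟨hi, hj⟩
    simp [hi, hj, ex_const]

theorem ex_indep_sq_sum (p : ι → PMF α) (s : Finset ι) (g : ι → α → ℝ)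
    (hg : ∀ i ∈ s, ex (p i) (g i) = 0) :
    ex (indep p) (fun x => (∑ i ∈ s, g i (x i)) ^ 2) = ∑ i ∈ s, ex (p i) fun a => g i a ^ 2 := by
  simp only [sq, Finset.sum_mul_sum, ex_sum]
  refine Finset.sum_congr rfl fun i hi => ?_
  rw [Finset.sum_eq_single i]
  · exact ex_indep_apply p i fun a => g i a * g i a
  · intro j _ hj
    rw [ex_indep_mul p hj.symm, hg i hi, zero_mul]
  · exact fun h => absurd hi h

theorem ex_indep_prodMk (p : ι → PMF α) (q : ι → PMF β) (f : (ι → α × β) → ℝ) :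
    ex (indep fun i => (p i).bind fun a => (q i).map (Prod.mk a)) f
      = ex (indep p) fun x => ex (indep q) fun y => f fun i => (x i, y i) := by
  rw [indep_bind p (fun i a => (q i).map (Prod.mk a)), ex_bind]
  congr 1
  ext x
  rw [indep_map q (fun i => Prod.mk (x i)), ex_map]

theorem ex_indep_indep {κ : Type} [Fintype κ] [DecidableEq κ] (p : κ → PMF α)
    (f : (ι → κ → α) → ℝ) :
    ex (indep fun _ : ι => indep p) f
      = ex (indep fun k => indep fun _ : ι => p k) fun y => f fun i k => y k i := by
  simp only [ex, indep_apply]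
  refine Fintype.sum_equiv (Equiv.piComm fun _ _ => α) _ _ fun x => ?_
  simp only [Equiv.piComm_apply]
  rw [Finset.prod_comm]

end Expectation

/-! ### Biased coins -/

/-- A coin that shows `true` with probability `p`. -/
def coin (p : ℝ) (h0 : 0 ≤ p) (h1 : p ≤ 1) : PMF Bool :=
  PMF.ofFintype (fun b => ENNReal.ofReal (if b then p else 1 - p)) (by
    rw [Fintype.sum_bool, ← ENNReal.ofReal_add] <;> simp [h0, h1])

theorem coin_apply (p : ℝ) (h0 : 0 ≤ p) (h1 : p ≤ 1) (b : Bool) :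
    coin p h0 h1 b = ENNReal.ofReal (if b then p else 1 - p) := by
  simp [coin]

theorem ex_coin (p : ℝ) (h0 : 0 ≤ p) (h1 : p ≤ 1) (f : Bool → ℝ) :
    ex (coin p h0 h1) f = p * f true + (1 - p) * f false := by
  simp [ex, coin_apply, h0, h1]

/-! ### Binomial moments -/

/-- The expectation of `f` under the binomial distribution of `n` trials of probability `p`. -/
def binomialEx (p : ℝ) : ℕ → (ℕ → ℝ) → ℝ
  | 0, f => f 0
  | n + 1, f => p * binomialEx p n (fun x => f (x + 1)) + (1 - p) * binomialEx p n f

theorem ex_indep_coin (p : ℝ) (h0 : 0 ≤ p) (h1 : p ≤ 1) {N : ℕ} (K : Fin N → Prop)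
    [DecidablePred K] (f : ℕ → ℝ) :
    ex (indep fun _ : Fin N => coin p h0 h1) (fun b => f #{s | K s ∧ b s = true})
      = binomialEx p #{s | K s} f := by
  induction N generalizing f with
  | zero => simp [binomialEx, ex, indep_apply]
  | succ N ih =>
    have hsplit : ∀ g : (Fin (N + 1) → Bool) → ℝ,
        ex (indep fun _ : Fin (N + 1) => coin p h0 h1) g
          = ex (coin p h0 h1) fun a => ex (indep fun _ : Fin N => coin p h0 h1) fun b =>
              g (Fin.cons a b) := by
      intro g
      simp only [ex, indep_apply]
      rw [← (Fin.consEquiv fun _ => Bool).sum_comp, Fintype.sum_prod_type]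
      simp only [Finset.mul_sum]
      refine Finset.sum_congr rfl fun a _ => Finset.sum_congr rfl fun b _ => ?_
      rw [Fin.prod_univ_succ, ENNReal.toReal_mul, mul_assoc]
      rfl
    rw [hsplit, ex_coin]
    simp only [Fin.card_filter_univ_succ, Fin.cons_zero, Fin.cons_succ]
    by_cases hK : K 0
    · simp only [hK, and_self, if_true, true_and, Bool.false_eq_true, if_false, binomialEx]
      rw [ih (fun s => K s.succ) (fun x => f (x + 1)), ih (fun s => K s.succ) f]
    · simp only [hK, false_and, if_false]
      rw [ih (fun s => K s.succ) f]
      ring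

theorem binomialEx_add (p : ℝ) (n : ℕ) (f g : ℕ → ℝ) :
    binomialEx p n (fun x => f x + g x) = binomialEx p n f + binomialEx p n g := by
  induction n generalizing f g with
  | zero => rfl
  | succ n ih =>
    simp only [binomialEx, ih f g, ih (fun x => f (x + 1)) (fun x => g (x + 1))]
    ring

theorem binomialEx_mul_left (p : ℝ) (n : ℕ) (c : ℝ) (f : ℕ → ℝ) :
    binomialEx p n (fun x => c * f x) = c * binomialEx p n f := by
  induction n generalizing f with
  | zero => rfl
  | succ n ih =>
    simp only [binomialEx, ih f, ih (fun x => f (x + 1))]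
    ring

theorem binomialEx_const (p : ℝ) (n : ℕ) (c : ℝ) : binomialEx p n (fun _ => c) = c := by
  induction n with
  | zero => rfl
  | succ n ih =>
    simp only [binomialEx, ih]
    ring

theorem binomialEx_id (p : ℝ) (n : ℕ) : binomialEx p n (fun x => (x : ℝ)) = n * p := by
  induction n with
  | zero => simp [binomialEx]
  | succ n ih =>
    simp only [binomialEx, Nat.cast_add, Nat.cast_one, binomialEx_add, binomialEx_const, ih]
    ring

theorem binomialEx_sq (p : ℝ) (n : ℕ) :
    binomialEx p n (fun x => (x : ℝ) ^ 2) = n * (n - 1) * p ^ 2 + n * p := by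
  induction n with
  | zero => simp [binomialEx]
  | succ n ih =>
    have h : (fun x : ℕ => ((x + 1 : ℕ) : ℝ) ^ 2) = fun x : ℕ => (x : ℝ) ^ 2 + (2 * x + 1) := by
      ext x
      push_cast
      ring
    simp only [binomialEx, h, binomialEx_add, binomialEx_const, binomialEx_mul_left,
      binomialEx_id, ih]
    push_cast
    ring

theorem binomialEx_cube (p : ℝ) (n : ℕ) :
    binomialEx p n (fun x => (x : ℝ) ^ 3)
      = n * (n - 1) * (n - 2) * p ^ 3 + 3 * (n * (n - 1) * p ^ 2) + n * p := by
  induction n with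
  | zero => simp [binomialEx]
  | succ n ih =>
    have h : (fun x : ℕ => ((x + 1 : ℕ) : ℝ) ^ 3)
        = fun x : ℕ => (x : ℝ) ^ 3 + (3 * (x : ℝ) ^ 2 + (3 * x + 1)) := by
      ext x
      push_cast
      ring
    simp only [binomialEx, h, binomialEx_add, binomialEx_const, binomialEx_mul_left,
      binomialEx_id, binomialEx_sq, ih]
    push_cast
    ring

theorem binomialEx_pow_four (p : ℝ) (n : ℕ) :
    binomialEx p n (fun x => (x : ℝ) ^ 4)
      = n * (n - 1) * (n - 2) * (n - 3) * p ^ 4 + 6 * (n * (n - 1) * (n - 2) * p ^ 3)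
        + 7 * (n * (n - 1) * p ^ 2) + n * p := by
  induction n with
  | zero => simp [binomialEx]
  | succ n ih =>
    have h : (fun x : ℕ => ((x + 1 : ℕ) : ℝ) ^ 4)
        = fun x : ℕ => (x : ℝ) ^ 4 + (4 * (x : ℝ) ^ 3 + (6 * (x : ℝ) ^ 2 + (4 * x + 1))) := by
      ext x
      push_cast
      ring
    simp only [binomialEx, h, binomialEx_add, binomialEx_const, binomialEx_mul_left,
      binomialEx_id, binomialEx_sq, binomialEx_cube, ih]
    push_cast
    ring

theorem binomialEx_quartic (p : ℝ) (n : ℕ) (a b c e g : ℝ) :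
    binomialEx p n (fun x => a + (b * x + (c * (x : ℝ) ^ 2 + (e * (x : ℝ) ^ 3 + g * (x : ℝ) ^ 4))))
      = a + b * (n * p) + c * (n * (n - 1) * p ^ 2 + n * p)
        + e * (n * (n - 1) * (n - 2) * p ^ 3 + 3 * (n * (n - 1) * p ^ 2) + n * p)
        + g * (n * (n - 1) * (n - 2) * (n - 3) * p ^ 4 + 6 * (n * (n - 1) * (n - 2) * p ^ 3)
          + 7 * (n * (n - 1) * p ^ 2) + n * p) := by
  simp only [binomialEx_add, binomialEx_const, binomialEx_mul_left, binomialEx_id, binomialEx_sq,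
    binomialEx_cube, binomialEx_pow_four]
  ring

/-! ### Mean and variance of one term of the statistic -/

/-- The mean of `statTerm k l` when the wins are binomial with success probabilities `p`, `q`. -/
def termMean (k l : ℕ) (p q : ℝ) : ℝ :=
  if 1 < k ∧ 1 < l then (k : ℝ) * l / (k + l) * (p - q) ^ 2 else 0

theorem termMean_nonneg (k l : ℕ) (p q : ℝ) : 0 ≤ termMean k l p q := by
  unfold termMean
  split_ifs <;> positivity

/-- The numerator of `statTerm`. -/
def statNum (k l : ℕ) (x y : ℝ) : ℝ :=
  (l : ℝ) * (l - 1) * (x ^ 2 - x) + (k : ℝ) * (k - 1) * (y ^ 2 - y)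
    - 2 * ((k : ℝ) - 1) * ((l : ℝ) - 1) * x * y

theorem binomialEx_statNum (k l : ℕ) (p q : ℝ) :
    binomialEx p k (fun x => binomialEx q l fun y => statNum k l x y)
      = ((k : ℝ) - 1) * (l - 1) * k * l * (p - q) ^ 2 := by
  have h1 : ∀ x : ℕ, (binomialEx q l fun y => statNum k l x y)
      = ((k : ℝ) * (k - 1)) * (l * (l - 1) * q ^ 2)
        + ((-((l : ℝ) * (l - 1)) - 2 * ((k : ℝ) - 1) * ((l : ℝ) - 1) * (l * q)) * x
        + ((l : ℝ) * (l - 1) * (x : ℝ) ^ 2 + (0 * (x : ℝ) ^ 3 + 0 * (x : ℝ) ^ 4))) := by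
    intro x
    have h2 : (fun y : ℕ => statNum k l x y) = fun y : ℕ =>
        ((l : ℝ) * (l - 1) * ((x : ℝ) ^ 2 - x))
        + ((-((k : ℝ) * (k - 1)) - 2 * ((k : ℝ) - 1) * ((l : ℝ) - 1) * x) * y
        + ((k : ℝ) * (k - 1) * (y : ℝ) ^ 2 + (0 * (y : ℝ) ^ 3 + 0 * (y : ℝ) ^ 4))) := by
      ext y
      rw [statNum]
      ring
    rw [h2, binomialEx_quartic]
    ring
  simp only [h1, binomialEx_quartic]
  ring

theorem binomialEx_statNum_sub_sq (k l : ℕ) (p q : ℝ) :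
    binomialEx p k (fun x => binomialEx q l fun y =>
        (statNum k l x y - ((k : ℝ) - 1) * (l - 1) * k * l * (p - q) ^ 2) ^ 2)
      = 4 * (p - q) ^ 2 * ((k - 1) * (l - 1)) ^ 2
          * (l ^ 2 * k * (p * (1 - p)) + k ^ 2 * l * (q * (1 - q)))
        + 2 * (l * (l - 1)) ^ 2 * (k * (k - 1)) * (p * (1 - p)) ^ 2
        + 2 * (k * (k - 1)) ^ 2 * (l * (l - 1)) * (q * (1 - q)) ^ 2
        + 4 * ((k - 1) * (l - 1)) ^ 2 * (k * l) * (p * (1 - p)) * (q * (1 - q)) := by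
  set A : ℝ := (l : ℝ) * (l - 1) with hA
  set B : ℝ := (k : ℝ) * (k - 1) with hB
  set G : ℝ := ((k : ℝ) - 1) * ((l : ℝ) - 1) with hG
  set M : ℝ := ((k : ℝ) - 1) * (l - 1) * k * l * (p - q) ^ 2 with hM
  set m₁ : ℝ := l * q with hm₁
  set m₂ : ℝ := l * (l - 1) * q ^ 2 + l * q with hm₂
  set m₃ : ℝ := l * (l - 1) * (l - 2) * q ^ 3 + 3 * (l * (l - 1) * q ^ 2) + l * q with hm₃
  set m₄ : ℝ := l * (l - 1) * (l - 2) * (l - 3) * q ^ 4 + 6 * (l * (l - 1) * (l - 2) * q ^ 3)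
          + 7 * (l * (l - 1) * q ^ 2) + l * q with hm₄
  have h1 : ∀ x : ℕ, (binomialEx q l fun y => (statNum k l x y - M) ^ 2)
      = (M ^ 2 + 2 * m₁ * M * B + (B ^ 2 - 2 * B * M) * m₂ - 2 * B ^ 2 * m₃ + B ^ 2 * m₄)
        + ((2 * A * M + 2 * m₁ * (A * B + 2 * G * M) + (4 * B * G - 2 * A * B) * m₂
            - 4 * B * G * m₃) * x
        + ((A ^ 2 - 2 * A * M - 2 * m₁ * (A * B - 2 * G * A) + (4 * G ^ 2 + 2 * A * B) * m₂)
            * (x : ℝ) ^ 2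
        + ((-2 * A ^ 2 - 4 * m₁ * G * A) * (x : ℝ) ^ 3 + A ^ 2 * (x : ℝ) ^ 4))) := by
    intro x
    have h2 : (fun y : ℕ => (statNum k l x y - M) ^ 2) = fun y : ℕ =>
        (A * ((x : ℝ) ^ 2 - x) - M) ^ 2
        + ((-2 * (A * ((x : ℝ) ^ 2 - x) - M) * (B + 2 * G * x)) * y
        + (((B + 2 * G * x) ^ 2 + 2 * (A * ((x : ℝ) ^ 2 - x) - M) * B) * (y : ℝ) ^ 2
        + ((-2 * B * (B + 2 * G * x)) * (y : ℝ) ^ 3 + B ^ 2 * (y : ℝ) ^ 4))) := by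
      ext y
      rw [statNum, ← hA, ← hB, mul_assoc 2, ← hG]
      ring
    rw [h2, binomialEx_quartic, ← hm₁, ← hm₂, ← hm₃, ← hm₄]
    ring
  simp only [h1, binomialEx_quartic]
  simp only [hA, hB, hG, hM, hm₁, hm₂, hm₃, hm₄]
  ring

theorem mul_one_sub_le_quarter (p : ℝ) : p * (1 - p) ≤ 1 / 4 := by
  nlinarith [sq_nonneg (p - 1 / 2)]

theorem statTerm_eq_statNum_div {k l : ℕ} (h : 1 < k ∧ 1 < l) (x y : ℕ) :
    statTerm k l x y = (((k : ℝ) - 1) * ((l : ℝ) - 1) * ((k : ℝ) + l))⁻¹ * statNum k l x y := by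
  rw [statTerm, if_pos h, div_eq_inv_mul, statNum]

theorem binomialEx_statTerm (k l : ℕ) (p q : ℝ) :
    binomialEx p k (fun x => binomialEx q l fun y => statTerm k l x y) = termMean k l p q := by
  by_cases h : 1 < k ∧ 1 < l
  · simp only [statTerm_eq_statNum_div h, binomialEx_mul_left, binomialEx_statNum]
    rw [termMean, if_pos h]
    have hk : (1 : ℝ) < k := by exact_mod_cast h.1
    have hl : (1 : ℝ) < l := by exact_mod_cast h.2
    have hk' : (k : ℝ) - 1 ≠ 0 := by linarith
    have hl' : (l : ℝ) - 1 ≠ 0 := by linarith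
    have hkl : (k : ℝ) + l ≠ 0 := by linarith
    field_simp
  · simp [statTerm, termMean, h, binomialEx_const]

theorem variance_quadratic_bound {k l : ℝ} (hk : 2 ≤ k) (hl : 2 ≤ l) {u v : ℝ} (hu0 : 0 ≤ u)
    (hu : u ≤ 1 / 4) (hv0 : 0 ≤ v) (hv : v ≤ 1 / 4) :
    2 * (l * (l - 1)) ^ 2 * (k * (k - 1)) * u ^ 2 + 2 * (k * (k - 1)) ^ 2 * (l * (l - 1)) * v ^ 2
      + 4 * ((k - 1) * (l - 1)) ^ 2 * (k * l) * u * v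
      ≤ 1 / 4 * ((k - 1) * (l - 1) * (k + l)) ^ 2 := by
  have hk1 : 0 ≤ k - 1 := by linarith
  have hl1 : 0 ≤ l - 1 := by linarith
  have hu2 : u ^ 2 ≤ 1 / 16 := by nlinarith
  have hv2 : v ^ 2 ≤ 1 / 16 := by nlinarith
  have huv : u * v ≤ 1 / 16 := by nlinarith
  have hkk : k * (k - 1) ≤ 2 * (k - 1) ^ 2 := by nlinarith
  have hll : l * (l - 1) ≤ 2 * (l - 1) ^ 2 := by nlinarith
  have a1 : 2 * (l * (l - 1)) ^ 2 * (k * (k - 1)) * u ^ 2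
      ≤ 2 * (l * (l - 1)) ^ 2 * (2 * (k - 1) ^ 2) * (1 / 16) := by gcongr
  have a2 : 2 * (k * (k - 1)) ^ 2 * (l * (l - 1)) * v ^ 2
      ≤ 2 * (k * (k - 1)) ^ 2 * (2 * (l - 1) ^ 2) * (1 / 16) := by gcongr
  have a3 : 4 * ((k - 1) * (l - 1)) ^ 2 * (k * l) * (u * v)
      ≤ 4 * ((k - 1) * (l - 1)) ^ 2 * (k * l) * (1 / 16) := by gcongr
  have a4 : 0 ≤ ((k - 1) * (l - 1)) ^ 2 * (k * l) := by positivity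
  linarith

theorem variance_linear_bound {k l : ℝ} (hk : 2 ≤ k) (hl : 2 ≤ l) {u v : ℝ} (hu : u ≤ 1 / 4)
    (hv : v ≤ 1 / 4) (s : ℝ) :
    4 * s ^ 2 * ((k - 1) * (l - 1)) ^ 2 * (l ^ 2 * k * u + k ^ 2 * l * v)
      ≤ k * l / (k + l) * s ^ 2 * ((k - 1) * (l - 1) * (k + l)) ^ 2 := by
  have h1 : l ^ 2 * k * u + k ^ 2 * l * v ≤ l ^ 2 * k * (1 / 4) + k ^ 2 * l * (1 / 4) := by
    gcongr
  have hkl : k + l ≠ 0 := by linarith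
  calc _ ≤ 4 * s ^ 2 * ((k - 1) * (l - 1)) ^ 2 * (l ^ 2 * k * (1 / 4) + k ^ 2 * l * (1 / 4)) := by
        gcongr
    _ = _ := by
        field_simp
        ring

theorem binomialEx_statTerm_sub_sq_le (k l : ℕ) {p q : ℝ} (hp0 : 0 ≤ p) (hp1 : p ≤ 1)
    (hq0 : 0 ≤ q) (hq1 : q ≤ 1) :
    binomialEx p k (fun x => binomialEx q l fun y => (statTerm k l x y - termMean k l p q) ^ 2)
      ≤ 1 / 4 + termMean k l p q := by
  by_cases h : 1 < k ∧ 1 < l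
  · have hk : (2 : ℝ) ≤ k := by exact_mod_cast h.1
    have hl : (2 : ℝ) ≤ l := by exact_mod_cast h.2
    have hk' : (k : ℝ) - 1 ≠ 0 := by linarith
    have hl' : (l : ℝ) - 1 ≠ 0 := by linarith
    have hkl : (k : ℝ) + l ≠ 0 := by linarith
    set D : ℝ := ((k : ℝ) - 1) * ((l : ℝ) - 1) * ((k : ℝ) + l) with hD
    have hD0 : D ≠ 0 := mul_ne_zero (mul_ne_zero hk' hl') hkl
    have hmean : termMean k l p q = D⁻¹ * (((k : ℝ) - 1) * (l - 1) * k * l * (p - q) ^ 2) := by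
      rw [termMean, if_pos h, hD]
      field_simp
    have hfun : ∀ x y : ℕ, (statTerm k l x y - termMean k l p q) ^ 2
        = (D⁻¹) ^ 2 * (statNum k l x y - ((k : ℝ) - 1) * (l - 1) * k * l * (p - q) ^ 2) ^ 2 := by
      intro x y
      rw [statTerm_eq_statNum_div h, hmean]
      ring
    simp only [hfun, binomialEx_mul_left, binomialEx_statNum_sub_sq]
    have b1 := variance_linear_bound hk hl (mul_one_sub_le_quarter p) (mul_one_sub_le_quarter q)
      (p - q)
    have b2 := variance_quadratic_bound hk hl (mul_nonneg hp0 (sub_nonneg.mpr hp1))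
      (mul_one_sub_le_quarter p) (mul_nonneg hq0 (sub_nonneg.mpr hq1)) (mul_one_sub_le_quarter q)
    rw [← hD] at b1 b2
    rw [termMean, if_pos h, inv_pow, inv_mul_le_iff₀ (by positivity)]
    linarith
  · simp [statTerm, termMean, h, binomialEx_const]

/-! ### Oriented matchings and Plackett–Luce rankings -/

/-- `C` consists of pairwise disjoint ordered pairs of distinct items. -/
def IsMatching {d : ℕ} (C : Finset (Fin d × Fin d)) : Prop :=
  (∀ p ∈ C, p.1 ≠ p.2) ∧
    ∀ p ∈ C, ∀ q ∈ C, p ≠ q → Disjoint ({p.1, p.2} : Finset (Fin d)) {q.1, q.2}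

/-- The items that occur in `C`. -/
def matchedItems {d : ℕ} (C : Finset (Fin d × Fin d)) : Finset (Fin d) :=
  C.biUnion fun p => {p.1, p.2}

/-- In the ranking `τ`, the first component of every pair of `C` beats the second one. -/
def Agrees {d m : ℕ} (C : Finset (Fin d × Fin d)) (τ : Fin m ↪ Fin d) : Prop :=
  ∀ p ∈ C, ∃ a b : Fin m, a < b ∧ p = (τ a, τ b)

theorem IsMatching.subset {d : ℕ} {C C' : Finset (Fin d × Fin d)} (h : IsMatching C)
    (hC : C' ⊆ C) : IsMatching C' :=
  ⟨fun p hp => h.1 p (hC hp), fun p hp q hq => h.2 p (hC hp) q (hC hq)⟩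

theorem fst_mem_matchedItems {d : ℕ} {C : Finset (Fin d × Fin d)} {p : Fin d × Fin d}
    (hp : p ∈ C) : p.1 ∈ matchedItems C :=
  Finset.mem_biUnion.mpr ⟨p, hp, by simp⟩

theorem snd_mem_matchedItems {d : ℕ} {C : Finset (Fin d × Fin d)} {p : Fin d × Fin d}
    (hp : p ∈ C) : p.2 ∈ matchedItems C :=
  Finset.mem_biUnion.mpr ⟨p, hp, by simp⟩

theorem IsMatching.eq_of_mem {d : ℕ} {C : Finset (Fin d × Fin d)} (h : IsMatching C)
    {p q : Fin d × Fin d} (hp : p ∈ C) (hq : q ∈ C) {x : Fin d} (hxp : x = p.1 ∨ x = p.2)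
    (hxq : x = q.1 ∨ x = q.2) : p = q := by
  by_contra hne
  exact Finset.disjoint_left.mp (h.2 p hp q hq hne) (by simpa using hxp) (by simpa using hxq)

theorem IsMatching.card_matchedItems {d : ℕ} {C : Finset (Fin d × Fin d)} (h : IsMatching C) :
    #(matchedItems C) = 2 * #C := by
  rw [matchedItems, Finset.card_biUnion fun p hp q hq => h.2 p hp q hq,
    Finset.sum_congr rfl fun p hp => Finset.card_pair (h.1 p hp)]
  simp [mul_comm]

theorem IsMatching.sum_matchedItems {d : ℕ} {C : Finset (Fin d × Fin d)} (h : IsMatching C)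
    (f : Fin d → ℝ) : ∑ i ∈ matchedItems C, f i = ∑ p ∈ C, (f p.1 + f p.2) := by
  rw [matchedItems, Finset.sum_biUnion fun p hp q hq => h.2 p hp q hq]
  exact Finset.sum_congr rfl fun p hp => Finset.sum_pair (h.1 p hp)

theorem pairwiseMatrix_mul_add {d : ℕ} (w : Fin d → ℝ) (i j : Fin d) :
    pairwiseMatrix w i j * (Real.exp (w i) + Real.exp (w j)) = Real.exp (w i) := by
  rw [pairwiseMatrix, Matrix.of_apply]
  have := Real.exp_pos (w i)
  have := Real.exp_pos (w j)
  field_simp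

theorem pairwiseMatrix_nonneg {d : ℕ} (w : Fin d → ℝ) (i j : Fin d) :
    0 ≤ pairwiseMatrix w i j := by
  rw [pairwiseMatrix, Matrix.of_apply]
  positivity

theorem pairwiseMatrix_swap {d : ℕ} (w : Fin d → ℝ) (i j : Fin d) :
    pairwiseMatrix w j i = 1 - pairwiseMatrix w i j := by
  simp only [pairwiseMatrix, Matrix.of_apply]
  have := Real.exp_pos (w i)
  have := Real.exp_pos (w j)
  field_simp
  ring

theorem pairwiseMatrix_le_one {d : ℕ} (w : Fin d → ℝ) (i j : Fin d) :
    pairwiseMatrix w i j ≤ 1 := by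
  have := pairwiseMatrix_nonneg w j i
  rw [pairwiseMatrix_swap] at this
  linarith

/-- The recursion on the top-ranked item for the probability that a ranking agrees with a
matching. -/
theorem IsMatching.sum_exp_mul_prod {d : ℕ} (w : Fin d → ℝ) {C : Finset (Fin d × Fin d)}
    (hC : IsMatching C) {S : Finset (Fin d)} (hS : matchedItems C ⊆ S) :
    ∑ i ∈ S, Real.exp (w i) * (if i ∉ C.image Prod.snd then
        ∏ p ∈ C with p.1 ≠ i, pairwiseMatrix w p.1 p.2 else 0)
      = (∑ i ∈ S, Real.exp (w i)) * ∏ p ∈ C, pairwiseMatrix w p.1 p.2 := by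
  rw [← Finset.sum_sdiff hS, ← Finset.sum_sdiff hS (f := fun i => Real.exp (w i)), add_mul]
  congr 1
  · rw [Finset.sum_mul]
    refine Finset.sum_congr rfl fun i hi => ?_
    have hi' := (Finset.mem_sdiff.mp hi).2
    rw [if_pos, Finset.filter_true_of_mem]
    · rintro p hp rfl
      exact hi' (fst_mem_matchedItems hp)
    · intro h
      obtain ⟨p, hp, rfl⟩ := Finset.mem_image.mp h
      exact hi' (snd_mem_matchedItems hp)
  · rw [hC.sum_matchedItems, hC.sum_matchedItems, Finset.sum_mul]
    refine Finset.sum_congr rfl fun p hp => ?_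
    rw [if_neg (not_not.mpr (Finset.mem_image_of_mem Prod.snd hp)), mul_zero, add_zero, if_pos]
    · have hfil : C.filter (fun q => q.1 ≠ p.1) = C.erase p := by
        ext q
        rw [Finset.mem_filter, Finset.mem_erase]
        constructor
        · rintro ⟨hq, hne⟩
          exact ⟨fun h => hne (by rw [h]), hq⟩
        · rintro ⟨hne, hq⟩
          exact ⟨hq, fun h => hne (hC.eq_of_mem hq hp (Or.inl rfl) (Or.inl h))⟩
      rw [hfil, ← Finset.mul_prod_erase C _ hp, ← mul_assoc, mul_comm (_ + _),
        pairwiseMatrix_mul_add]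
    · intro h
      obtain ⟨q, hq, hqp⟩ := Finset.mem_image.mp h
      have hqe := hC.eq_of_mem hq hp (Or.inr hqp.symm) (Or.inl rfl)
      rw [hqe] at hqp
      exact hC.1 p hp hqp.symm

theorem agrees_cons_iff {d m : ℕ} {C : Finset (Fin d × Fin d)} (hC : IsMatching C)
    {S : Finset (Fin d)} (hS : matchedItems C ⊆ S) (e : Fin m ↪ Fin d) (i : Fin d)
    (hi : i ∉ Set.range e) (τ : Fin (m + 1) ↪ Fin d) (h0 : τ 0 = i)
    (hs : ∀ k : Fin m, τ k.succ = e k) :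
    univ.map τ = S ∧ Agrees C τ ↔
      (i ∈ S ∧ i ∉ C.image Prod.snd) ∧
        (univ.map e = S.erase i ∧ Agrees (C.filter fun p => p.1 ≠ i) e) := by
  have hi' : i ∉ univ.map e := by simpa using hi
  have hmap : univ.map τ = insert i (univ.map e) := by
    ext x
    simp only [Finset.mem_map, Finset.mem_univ, true_and, Finset.mem_insert, Fin.exists_fin_succ,
      h0, hs]
    exact or_congr_left eq_comm
  have hiff : univ.map τ = S ↔ i ∈ S ∧ univ.map e = S.erase i := by
    rw [hmap]
    constructor
    · intro h
      rw [← h]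
      exact ⟨Finset.mem_insert_self _ _, (Finset.erase_insert hi').symm⟩
    · rintro ⟨h', h⟩
      rw [h, Finset.insert_erase h']
  rw [hiff]
  constructor
  · rintro ⟨⟨hiS, he⟩, hA⟩
    refine ⟨⟨hiS, fun h => ?_⟩, he, fun p hp => ?_⟩
    · obtain ⟨p, hp, hpi⟩ := Finset.mem_image.mp h
      obtain ⟨a, b, hab, rfl⟩ := hA p hp
      obtain ⟨b, rfl⟩ := Fin.exists_succ_eq.mpr (Fin.ne_zero_of_lt hab)
      exact hi ⟨b, by rw [← hs]; exact hpi⟩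
    · obtain ⟨hpC, hpi⟩ := Finset.mem_filter.mp hp
      obtain ⟨a, b, hab, rfl⟩ := hA p hpC
      obtain ⟨b, rfl⟩ := Fin.exists_succ_eq.mpr (Fin.ne_zero_of_lt hab)
      have ha : a ≠ 0 := by
        rintro rfl
        exact hpi h0
      obtain ⟨a, rfl⟩ := Fin.exists_succ_eq.mpr ha
      exact ⟨a, b, Fin.succ_lt_succ_iff.mp hab, by rw [hs, hs]⟩
  · rintro ⟨⟨hiS, hiC⟩, he, hA⟩
    refine ⟨⟨hiS, he⟩, fun p hp => ?_⟩
    by_cases hpi : p.1 = i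
    · have hp2 : p.2 ∈ univ.map e := by
        rw [he, Finset.mem_erase]
        exact ⟨fun h => hC.1 p hp (hpi.trans h.symm), hS (snd_mem_matchedItems hp)⟩
      obtain ⟨b, -, hb⟩ := Finset.mem_map.mp hp2
      exact ⟨0, b.succ, Fin.succ_pos b, Prod.ext (by rw [h0, hpi]) (by rw [hs, hb])⟩
    · obtain ⟨a, b, hab, h⟩ := hA p (Finset.mem_filter.mpr ⟨hp, hpi⟩)
      exact ⟨a.succ, b.succ, Fin.succ_lt_succ_iff.mpr hab, by rw [hs, hs, h]⟩

open Classical in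
/-- Under the Plackett–Luce model, disjoint pairs of items are compared independently. -/
theorem sum_plWeight_agrees {d : ℕ} (w : Fin d → ℝ) (m : ℕ) (S : Finset (Fin d)) (hS : #S = m)
    (C : Finset (Fin d × Fin d)) (hC : IsMatching C) (hCS : matchedItems C ⊆ S) :
    ∑ τ : Fin m ↪ Fin d, (if univ.map τ = S ∧ Agrees C τ then plWeight w τ else 0)
      = ∏ p ∈ C, pairwiseMatrix w p.1 p.2 := by
  induction m generalizing S C with
  | zero =>
    have h : S = ∅ := Finset.card_eq_zero.mp hS
    subst h
    have hC0 : C = ∅ := Finset.eq_empty_of_forall_notMem fun p hp =>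
      Finset.notMem_empty _ (hCS (fst_mem_matchedItems hp))
    subst hC0
    simp [plWeight, Agrees]
  | succ m ih =>
    have hpos : 0 < ∑ k ∈ S, Real.exp (w k) :=
      Finset.sum_pos (fun _ _ => Real.exp_pos _) (Finset.card_pos.mp (by omega))
    have key : ∀ (e : Fin m ↪ Fin d) (i : {i // i ∉ Set.range e}),
        (if univ.map ((Equiv.embeddingFinSucc m (Fin d)).symm ⟨e, i⟩) = S
            ∧ Agrees C ((Equiv.embeddingFinSucc m (Fin d)).symm ⟨e, i⟩)
          then plWeight w ((Equiv.embeddingFinSucc m (Fin d)).symm ⟨e, i⟩) else 0)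
        = if (i.1 ∈ S ∧ i.1 ∉ C.image Prod.snd)
              ∧ (univ.map e = S.erase i.1 ∧ Agrees (C.filter fun p => p.1 ≠ i.1) e)
          then Real.exp (w i.1) / (∑ k ∈ S, Real.exp (w k)) * plWeight w e else 0 := by
      intro e i
      set τ := (Equiv.embeddingFinSucc m (Fin d)).symm ⟨e, i⟩ with hτ
      have h0 : τ 0 = i.1 := by simp [hτ]
      have hs : ∀ k : Fin m, τ k.succ = e k := by intro k; simp [hτ]
      simp only [agrees_cons_iff hC hCS e i.1 i.2 τ h0 hs]
      split_ifs with hc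
      · have hc' := ((agrees_cons_iff hC hCS e i.1 i.2 τ h0 hs).mpr hc).1
        unfold plWeight
        rw [Fin.prod_univ_succ]
        congr 1
        · have hI : Finset.Ici (0 : Fin (m + 1)) = univ := by
            ext j
            simp
          rw [h0, ← hc', Finset.sum_map, hI]
        · refine Finset.prod_congr rfl fun j _ => ?_
          rw [hs, ← Fin.map_succEmb_Ici, Finset.sum_map]
          simp [hs]
      · rfl
    rw [← (Equiv.embeddingFinSucc m (Fin d)).symm.sum_comp, Fintype.sum_sigma]
    simp_rw [key]
    have key2 : ∀ e : Fin m ↪ Fin d,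
        (∑ i : {i // i ∉ Set.range e}, if (i.1 ∈ S ∧ i.1 ∉ C.image Prod.snd)
              ∧ (univ.map e = S.erase i.1 ∧ Agrees (C.filter fun p => p.1 ≠ i.1) e)
          then Real.exp (w i.1) / (∑ k ∈ S, Real.exp (w k)) * plWeight w e else 0)
        = ∑ i ∈ S, Real.exp (w i) / (∑ k ∈ S, Real.exp (w k))
            * (if i ∉ C.image Prod.snd then
                (if univ.map e = S.erase i ∧ Agrees (C.filter fun p => p.1 ≠ i) e
                  then plWeight w e else 0) else 0) := by
      intro e
      rw [← Finset.sum_subtype (Finset.univ.filter fun i => i ∉ Set.range e) (by simp)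
        (fun i => if (i ∈ S ∧ i ∉ C.image Prod.snd)
              ∧ (univ.map e = S.erase i ∧ Agrees (C.filter fun p => p.1 ≠ i) e)
          then Real.exp (w i) / (∑ k ∈ S, Real.exp (w k)) * plWeight w e else 0)]
      rw [Finset.sum_filter, ← Finset.sum_subset (Finset.subset_univ S)]
      · refine Finset.sum_congr rfl fun i hi => ?_
        by_cases h : univ.map e = S.erase i ∧ Agrees (C.filter fun p => p.1 ≠ i) e
        · have hr : i ∉ Set.range e := by
            have : i ∉ univ.map e := by rw [h.1]; simp
            simpa using this
          rw [if_pos hr, if_pos h]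
          by_cases h2 : i ∉ C.image Prod.snd
          · rw [if_pos ⟨⟨hi, h2⟩, h⟩, if_pos h2]
          · rw [if_neg (fun h3 => h2 h3.1.2), if_neg h2, mul_zero]
        · simp only [h, and_false, if_false, ite_self, mul_zero]
      · intro i _ hi
        simp only [hi, false_and, if_false, ite_self]
    simp_rw [key2]
    rw [Finset.sum_comm]
    simp_rw [← Finset.mul_sum]
    have key3 : ∀ i ∈ S, (∑ e : Fin m ↪ Fin d, (if i ∉ C.image Prod.snd then
                (if univ.map e = S.erase i ∧ Agrees (C.filter fun p => p.1 ≠ i) e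
                  then plWeight w e else 0) else 0))
        = if i ∉ C.image Prod.snd then
            ∏ p ∈ C with p.1 ≠ i, pairwiseMatrix w p.1 p.2 else 0 := by
      intro i hi
      by_cases h : i ∉ C.image Prod.snd
      · simp only [if_pos h]
        refine ih (S.erase i) (by rw [Finset.card_erase_of_mem hi]; omega) _
          (hC.subset (Finset.filter_subset _ _)) fun x hx => ?_
        obtain ⟨p, hp, hxp⟩ := Finset.mem_biUnion.mp hx
        obtain ⟨hpC, hpi⟩ := Finset.mem_filter.mp hp
        refine Finset.mem_erase.mpr ⟨?_, hCS (Finset.mem_biUnion.mpr ⟨p, hpC, hxp⟩)⟩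
        rintro rfl
        rcases Finset.mem_insert.mp hxp with hx1 | hx2
        · exact hpi hx1.symm
        · exact h (Finset.mem_image.mpr ⟨p, hpC, (Finset.mem_singleton.mp hx2).symm⟩)
      · simp only [if_neg h, Finset.sum_const_zero]
    rw [Finset.sum_congr rfl fun i hi => by rw [key3 i hi]]
    simp_rw [div_mul_eq_mul_div]
    rw [← Finset.sum_div, hC.sum_exp_mul_prod w hCS, mul_div_assoc,
      mul_comm, div_mul_cancel₀ _ hpos.ne']

/-! ### The distribution of the comparisons obtained from one sample -/

theorem isMatching_map {d d' : ℕ} (f : Fin d ↪ Fin d') (C : Finset (Fin d × Fin d)) :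
    IsMatching (C.map (f.prodMap f)) ↔ IsMatching C := by
  simp only [IsMatching, Finset.forall_mem_map]
  simp [Finset.disjoint_left]

theorem mem_disjointBreakings_iff {d m : ℕ} (τ : Fin m ↪ Fin d) (C : Finset (Fin d × Fin d)) :
    C ∈ disjointBreakings τ ↔ (IsMatching C ∧ #C = m / 2) ∧ Agrees C τ := by
  simp only [disjointBreakings, Finset.mem_filter, Finset.mem_univ, true_and]
  constructor
  · rintro ⟨hc, hA, hd⟩
    refine ⟨⟨⟨fun p hp => ?_, hd⟩, hc⟩, hA⟩
    obtain ⟨a, b, hab, rfl⟩ := hA p hp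
    exact fun h => hab.ne (τ.injective h)
  · rintro ⟨⟨hM, hc⟩, hA⟩
    exact ⟨hc, hA, hM.2⟩

theorem agrees_map_iff {d m : ℕ} (τ : Fin m ↪ Fin d) (C : Finset (Fin m × Fin m)) :
    Agrees (C.map (τ.prodMap τ)) τ ↔ Agrees C (Function.Embedding.refl (Fin m)) := by
  simp only [Agrees, Finset.forall_mem_map]
  simp

theorem card_disjointBreakings {d m : ℕ} (τ : Fin m ↪ Fin d) :
    #(disjointBreakings τ) = #(disjointBreakings (Function.Embedding.refl (Fin m))) := by
  symm
  refine Finset.card_bij (fun C _ => C.map (τ.prodMap τ)) (fun C hC => ?_)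
    (fun C _ C' _ h => Finset.map_injective _ h) (fun C hC => ?_)
  · rw [mem_disjointBreakings_iff] at hC ⊢
    rwa [isMatching_map, Finset.card_map, agrees_map_iff]
  · rw [mem_disjointBreakings_iff] at hC
    have hsub : C ⊆ univ.map (τ.prodMap τ) := by
      intro p hp
      obtain ⟨a, b, -, rfl⟩ := hC.2 p hp
      exact Finset.mem_map.mpr ⟨(a, b), Finset.mem_univ _, rfl⟩
    obtain ⟨C', -, rfl⟩ := Finset.subset_map_iff.mp hsub
    refine ⟨C', ?_, rfl⟩
    rw [mem_disjointBreakings_iff]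
    rwa [isMatching_map, Finset.card_map, agrees_map_iff] at hC

theorem card_supersets {d : ℕ} (m : ℕ) (A : Finset (Fin d)) (hA : #A ≤ m) :
    #{S : Finset (Fin d) | #S = m ∧ A ⊆ S} = (d - #A).choose (m - #A) := by
  have h : #(Finset.powersetCard (m - #A) (univ \ A)) = (d - #A).choose (m - #A) := by
    rw [Finset.card_powersetCard, Finset.card_sdiff_of_subset (Finset.subset_univ A),
      Finset.card_univ, Fintype.card_fin]
  rw [← h]
  refine Finset.card_nbij' (fun S => S \ A) (fun S => S ∪ A) ?_ ?_ ?_ ?_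
  · intro S hS
    simp only [Finset.coe_filter, Finset.mem_univ, true_and, Set.mem_ofPred_eq] at hS
    rw [Finset.mem_coe, Finset.mem_powersetCard, Finset.card_sdiff_of_subset hS.2, hS.1]
    exact ⟨Finset.sdiff_subset_sdiff (Finset.subset_univ S) le_rfl, rfl⟩
  · intro S hS
    rw [Finset.mem_coe, Finset.mem_powersetCard] at hS
    have hd : Disjoint S A := Finset.disjoint_of_subset_left hS.1 Finset.sdiff_disjoint
    simp only [Finset.coe_filter, Finset.mem_univ, true_and, Set.mem_ofPred_eq,
      Finset.card_union_of_disjoint hd, hS.2]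
    exact ⟨by omega, Finset.subset_union_right⟩
  · intro S hS
    simp only [Finset.coe_filter, Finset.mem_univ, true_and, Set.mem_ofPred_eq] at hS
    exact Finset.sdiff_union_of_subset hS.2
  · intro S hS
    rw [Finset.mem_coe, Finset.mem_powersetCard] at hS
    have hd : Disjoint S A := Finset.disjoint_of_subset_left hS.1 Finset.sdiff_disjoint
    exact Finset.union_sdiff_cancel_right hd

theorem Agrees.matchedItems_subset {d m : ℕ} {C : Finset (Fin d × Fin d)} {τ : Fin m ↪ Fin d}
    (h : Agrees C τ) : matchedItems C ⊆ univ.map τ := by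
  intro x hx
  obtain ⟨p, hp, hxp⟩ := Finset.mem_biUnion.mp hx
  obtain ⟨a, b, -, rfl⟩ := h p hp
  rcases Finset.mem_insert.mp hxp with rfl | h2
  · exact Finset.mem_map_of_mem τ (Finset.mem_univ a)
  · rw [Finset.mem_singleton.mp h2]
    exact Finset.mem_map_of_mem τ (Finset.mem_univ b)

/-- The comparisons obtained from one sample by random disjoint rank breaking. -/
def breakingSample {d m : ℕ} (h : m ≤ d) (w : Fin d → ℝ) : PMF (Finset (Fin d × Fin d)) :=
  (rankingSample h w).bind randomDisjoint

open Classical in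
/-- The unnormalized probability of the comparisons `C` among `n` disjoint pairs of items. -/
def matchingWeight {d : ℕ} (n : ℕ) (w : Fin d → ℝ) (C : Finset (Fin d × Fin d)) : ℝ≥0∞ :=
  if IsMatching C ∧ #C = n then ENNReal.ofReal (∏ p ∈ C, pairwiseMatrix w p.1 p.2) else 0

theorem sum_plRanking_mul_randomDisjoint {d m : ℕ} (w : Fin d → ℝ)
    (Ω : {S : Finset (Fin d) // #S = m}) (C : Finset (Fin d × Fin d)) :
    ∑ τ, plRanking w Ω τ * randomDisjoint τ C
      = (#(disjointBreakings (Function.Embedding.refl (Fin m))) : ℝ≥0∞)⁻¹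
        * if matchedItems C ⊆ Ω.1 then matchingWeight (m / 2) w C else 0 := by
  classical
  have hr : ∀ τ : Fin m ↪ Fin d, randomDisjoint τ C = if C ∈ disjointBreakings τ then
      (#(disjointBreakings (Function.Embedding.refl (Fin m))) : ℝ≥0∞)⁻¹ else 0 := by
    intro τ
    rw [randomDisjoint, PMF.uniformOfFinset_apply, card_disjointBreakings τ]
    split_ifs <;> rfl
  have hp : ∀ τ : Fin m ↪ Fin d, plRanking w Ω τ
      = if univ.map τ = Ω.1 then ENNReal.ofReal (plWeight w τ) else 0 := by
    intro τ
    simp [plRanking]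
  have hterm : ∀ τ : Fin m ↪ Fin d, plRanking w Ω τ * randomDisjoint τ C
      = (#(disjointBreakings (Function.Embedding.refl (Fin m))) : ℝ≥0∞)⁻¹
        * if IsMatching C ∧ #C = m / 2 then ENNReal.ofReal
            (if univ.map τ = Ω.1 ∧ Agrees C τ then plWeight w τ else 0) else 0 := by
    intro τ
    simp only [hr, hp, mem_disjointBreakings_iff]
    by_cases h1 : IsMatching C ∧ #C = m / 2 <;> by_cases h2 : Agrees C τ <;>
      by_cases h3 : univ.map τ = Ω.1 <;> simp [h1, h2, h3, mul_comm]
  simp only [hterm, ← Finset.mul_sum]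
  congr 1
  by_cases h1 : IsMatching C ∧ #C = m / 2
  · simp only [matchingWeight, if_pos h1]
    rw [← ENNReal.ofReal_sum_of_nonneg]
    · by_cases h2 : matchedItems C ⊆ Ω.1
      · rw [if_pos h2, sum_plWeight_agrees w m Ω.1 Ω.2 C h1.1 h2]
      · rw [if_neg h2, Finset.sum_eq_zero, ENNReal.ofReal_zero]
        intro τ _
        rw [if_neg]
        rintro ⟨h3, h4⟩
        exact h2 (h3 ▸ h4.matchedItems_subset)
    · intro τ _
      split_ifs
      exacts [plWeight_nonneg w τ, le_rfl]
  · simp [matchingWeight, h1]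

theorem exists_breakingSample_apply {d m : ℕ} (h : m ≤ d) (w : Fin d → ℝ) :
    ∃ Z : ℝ≥0∞, ∀ C, breakingSample h w C = Z * matchingWeight (m / 2) w C := by
  classical
  have := nonempty_subsets h
  refine ⟨(Fintype.card {S : Finset (Fin d) // #S = m} : ℝ≥0∞)⁻¹
    * ((#(disjointBreakings (Function.Embedding.refl (Fin m))) : ℝ≥0∞)⁻¹
      * ((d - 2 * (m / 2)).choose (m - 2 * (m / 2)) : ℕ)), fun C => ?_⟩
  have h1 : breakingSample h w C = ∑ Ω : {S : Finset (Fin d) // #S = m},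
      (Fintype.card {S : Finset (Fin d) // #S = m} : ℝ≥0∞)⁻¹
        * ∑ τ, plRanking w Ω τ * randomDisjoint τ C := by
    rw [breakingSample, rankingSample, PMF.bind_bind, PMF.bind_apply, tsum_fintype]
    refine Finset.sum_congr rfl fun Ω _ => ?_
    rw [PMF.uniformOfFintype_apply, PMF.bind_apply, tsum_fintype]
  rw [h1]
  simp only [sum_plRanking_mul_randomDisjoint, ← Finset.mul_sum, mul_assoc]
  congr 2
  by_cases hC : IsMatching C ∧ #C = m / 2
  · have hcard : #(matchedItems C) = 2 * (m / 2) := by rw [hC.1.card_matchedItems, hC.2]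
    rw [← Finset.sum_subtype (univ.filter fun S : Finset (Fin d) => #S = m) (by simp)
      (fun S => if matchedItems C ⊆ S then matchingWeight (m / 2) w C else 0),
      ← Finset.sum_filter, Finset.filter_filter, Finset.sum_const,
      card_supersets m _ (by rw [hcard]; omega), hcard, nsmul_eq_mul]
  · simp [matchingWeight, hC]

/-! ### Matchings as a random set of unordered pairs with independent outcomes -/

open Classical in
/-- The sets of `n` disjoint unordered pairs of items, each represented by an increasing pair. -/
def skeletons (d n : ℕ) : Finset (Finset (Fin d × Fin d)) :=
  {U | IsMatching U ∧ #U = n ∧ ∀ p ∈ U, p.1 < p.2}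

theorem mem_skeletons {d n : ℕ} {U : Finset (Fin d × Fin d)} :
    U ∈ skeletons d n ↔ IsMatching U ∧ #U = n ∧ ∀ p ∈ U, p.1 < p.2 := by
  simp [skeletons]

theorem skeletons_nonempty {d m : ℕ} (h : m ≤ d) : (skeletons d (m / 2)).Nonempty := by
  obtain ⟨C, hC⟩ := disjointBreakings_nonempty (Fin.castLEEmb h)
  rw [mem_disjointBreakings_iff] at hC
  refine ⟨C, mem_skeletons.mpr ⟨hC.1.1, hC.1.2, fun p hp => ?_⟩⟩
  obtain ⟨a, b, hab, rfl⟩ := hC.2 p hp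
  exact hab

/-- The increasing rearrangement of a pair. -/
def sortPair {d : ℕ} (p : Fin d × Fin d) : Fin d × Fin d := if p.1 < p.2 then p else p.swap

/-- The pair `p`, reversed unless `b` is true. -/
def flipPair {d : ℕ} (b : Bool) (p : Fin d × Fin d) : Fin d × Fin d := if b then p else p.swap

/-- The comparisons of the pairs in `U` in which `p.1` beats `p.2` if and only if `b p`. -/
def orient {d : ℕ} (U : Finset (Fin d × Fin d)) (b : Fin d × Fin d → Bool) :
    Finset (Fin d × Fin d) :=
  U.image fun p => flipPair (b p) p

theorem sortPair_flipPair {d : ℕ} (b : Bool) {p : Fin d × Fin d} (hp : p.1 < p.2) :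
    sortPair (flipPair b p) = p := by
  cases b <;> simp [sortPair, flipPair, hp, hp.le, not_lt]

theorem pair_flipPair {d : ℕ} (b : Bool) (p : Fin d × Fin d) :
    ({(flipPair b p).1, (flipPair b p).2} : Finset (Fin d)) = {p.1, p.2} := by
  cases b <;> simp [flipPair, Finset.pair_comm]

theorem image_sortPair_orient {d : ℕ} {U : Finset (Fin d × Fin d)} (hU : ∀ p ∈ U, p.1 < p.2)
    (b : Fin d × Fin d → Bool) : (orient U b).image sortPair = U := by
  rw [orient, Finset.image_image]
  conv_rhs => rw [← Finset.image_id (s := U)]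
  exact Finset.image_congr fun p hp => sortPair_flipPair (b p) (hU p hp)

theorem mem_orient {d : ℕ} {U : Finset (Fin d × Fin d)} (hU : ∀ p ∈ U, p.1 < p.2)
    (b : Fin d × Fin d → Bool) {p : Fin d × Fin d} (hp : p.1 < p.2) :
    p ∈ orient U b ↔ p ∈ U ∧ b p = true := by
  rw [orient, Finset.mem_image]
  constructor
  · rintro ⟨q, hq, rfl⟩
    cases hb : b q
    · rw [hb] at hp
      exact absurd hp (hU q hq).not_gt
    · exact ⟨hq, hb⟩
  · rintro ⟨h1, h2⟩
    exact ⟨p, h1, by simp [h2, flipPair]⟩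

theorem swap_mem_orient {d : ℕ} {U : Finset (Fin d × Fin d)} (hU : ∀ p ∈ U, p.1 < p.2)
    (b : Fin d × Fin d → Bool) {p : Fin d × Fin d} (hp : p.1 < p.2) :
    p.swap ∈ orient U b ↔ p ∈ U ∧ b p = false := by
  rw [orient, Finset.mem_image]
  constructor
  · rintro ⟨q, hq, hqp⟩
    have hqp' : q = p := by
      rw [← sortPair_flipPair (b q) (hU q hq), hqp]
      exact sortPair_flipPair false hp
    subst hqp'
    refine ⟨hq, ?_⟩
    cases hb : b q
    · rfl
    · rw [hb] at hqp
      have h1 : q.1 = q.2 := congrArg Prod.fst hqp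
      exact absurd h1 hp.ne
  · rintro ⟨h1, h2⟩
    exact ⟨p, h1, by simp [h2, flipPair]⟩

theorem isMatching_orient {d n : ℕ} {U : Finset (Fin d × Fin d)} (hU : U ∈ skeletons d n)
    (b : Fin d × Fin d → Bool) : IsMatching (orient U b) ∧ #(orient U b) = n := by
  obtain ⟨hM, hn, hlt⟩ := mem_skeletons.mp hU
  refine ⟨⟨fun p hp => ?_, fun p hp q hq hpq => ?_⟩, ?_⟩
  · obtain ⟨p, hp', rfl⟩ := Finset.mem_image.mp hp
    cases b p
    · exact (hM.1 p hp').symm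
    · exact hM.1 p hp'
  · obtain ⟨p, hp', rfl⟩ := Finset.mem_image.mp hp
    obtain ⟨q, hq', rfl⟩ := Finset.mem_image.mp hq
    rw [pair_flipPair, pair_flipPair]
    exact hM.2 p hp' q hq' fun h => hpq (by rw [h])
  · rw [orient, Finset.card_image_of_injOn, hn]
    intro p hp q hq hpq
    rw [← sortPair_flipPair (b p) (hlt p hp), ← sortPair_flipPair (b q) (hlt q hq)]
    exact congrArg sortPair hpq

theorem IsMatching.sortPair_injOn {d : ℕ} {C : Finset (Fin d × Fin d)} (hC : IsMatching C) :
    Set.InjOn sortPair (C : Set (Fin d × Fin d)) := by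
  intro p hp q hq h
  refine hC.eq_of_mem hp hq (x := (sortPair p).1) ?_ ?_
  · unfold sortPair
    split_ifs <;> simp
  · rw [h]
    unfold sortPair
    split_ifs <;> simp

theorem IsMatching.swap_notMem {d : ℕ} {C : Finset (Fin d × Fin d)} (hC : IsMatching C)
    {p : Fin d × Fin d} (hp : p ∈ C) : p.swap ∉ C := by
  intro h
  have h1 := hC.eq_of_mem hp h (Or.inl rfl) (Or.inr rfl)
  exact hC.1 p hp (congrArg Prod.fst h1)

theorem IsMatching.sortPair_lt {d : ℕ} {C : Finset (Fin d × Fin d)} (hC : IsMatching C)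
    {p : Fin d × Fin d} (hp : p ∈ C) : (sortPair p).1 < (sortPair p).2 := by
  unfold sortPair
  split_ifs with h
  · exact h
  · exact lt_of_le_of_ne (not_lt.mp h) (hC.1 p hp).symm

theorem IsMatching.flipPair_sortPair {d : ℕ} {C : Finset (Fin d × Fin d)} (hC : IsMatching C)
    {p : Fin d × Fin d} (hp : p ∈ C) :
    flipPair (decide (sortPair p ∈ C)) (sortPair p) = p := by
  by_cases h : p.1 < p.2
  · simp [sortPair, h, hp, flipPair]
  · simp [sortPair, h, hC.swap_notMem hp, flipPair]

theorem IsMatching.image_sortPair_mem_skeletons {d : ℕ} {C : Finset (Fin d × Fin d)}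
    (hC : IsMatching C) : C.image sortPair ∈ skeletons d #C := by
  have hpair : ∀ p : Fin d × Fin d,
      ({(sortPair p).1, (sortPair p).2} : Finset (Fin d)) = {p.1, p.2} := by
    intro p
    unfold sortPair
    split_ifs
    · rfl
    · exact Finset.pair_comm _ _
  refine mem_skeletons.mpr ⟨⟨fun p hp => ?_, fun p hp q hq hpq => ?_⟩,
    Finset.card_image_of_injOn hC.sortPair_injOn, fun p hp => ?_⟩
  · obtain ⟨p, hp', rfl⟩ := Finset.mem_image.mp hp
    exact (hC.sortPair_lt hp').ne
  · obtain ⟨p, hp', rfl⟩ := Finset.mem_image.mp hp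
    obtain ⟨q, hq', rfl⟩ := Finset.mem_image.mp hq
    rw [hpair, hpair]
    exact hC.2 p hp' q hq' fun h => hpq (by rw [h])
  · obtain ⟨p, hp', rfl⟩ := Finset.mem_image.mp hp
    exact hC.sortPair_lt hp'

theorem orient_eq_iff {d : ℕ} {U C : Finset (Fin d × Fin d)} (hU : ∀ p ∈ U, p.1 < p.2)
    (hC : IsMatching C) (b : Fin d × Fin d → Bool) :
    C = orient U b ↔ U = C.image sortPair ∧ ∀ p ∈ C.image sortPair, b p = decide (p ∈ C) := by
  constructor
  · rintro rfl
    rw [image_sortPair_orient hU]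
    refine ⟨rfl, fun p hp => ?_⟩
    cases hb : b p <;> simp [mem_orient hU b (hU p hp), hp, hb]
  · rintro ⟨rfl, hb⟩
    rw [orient, Finset.image_image]
    conv_lhs => rw [← Finset.image_id (s := C)]
    refine Finset.image_congr fun p hp => ?_
    simp only [Function.comp_apply, id]
    rw [hb _ (Finset.mem_image_of_mem _ hp), hC.flipPair_sortPair hp]

/-- Independent outcomes of the comparisons of all pairs of items. -/
def outcomes {d : ℕ} (w : Fin d → ℝ) : PMF (Fin d × Fin d → Bool) :=
  indep fun p => coin (pairwiseMatrix w p.1 p.2) (pairwiseMatrix_nonneg w _ _)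
    (pairwiseMatrix_le_one w _ _)

theorem outcomes_map_orient_apply {d : ℕ} (w : Fin d → ℝ) {U C : Finset (Fin d × Fin d)}
    (hU : ∀ p ∈ U, p.1 < p.2) (hC : IsMatching C) :
    ((outcomes w).map (orient U)) C = if U = C.image sortPair then
      ENNReal.ofReal (∏ p ∈ C, pairwiseMatrix w p.1 p.2) else 0 := by
  classical
  rw [PMF.map_apply, tsum_fintype]
  simp only [orient_eq_iff hU hC]
  by_cases h : U = C.image sortPair
  · simp only [h, true_and, if_true, outcomes, indep_apply]
    have hterm : ∀ b : Fin d × Fin d → Bool,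
        (if ∀ p ∈ C.image sortPair, b p = decide (p ∈ C) then
          ∏ p, coin (pairwiseMatrix w p.1 p.2) (pairwiseMatrix_nonneg w _ _)
            (pairwiseMatrix_le_one w _ _) (b p) else 0)
        = ∏ p, if p ∈ C.image sortPair → b p = decide (p ∈ C) then
            coin (pairwiseMatrix w p.1 p.2) (pairwiseMatrix_nonneg w _ _)
              (pairwiseMatrix_le_one w _ _) (b p) else 0 := by
      intro b
      split_ifs with hb
      · exact Finset.prod_congr rfl fun p _ => by rw [if_pos (hb p)]
      · push Not at hb
        obtain ⟨p, hp, hbp⟩ := hb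
        refine (Finset.prod_eq_zero (Finset.mem_univ p) (if_neg fun h' => hbp (h' hp))).symm
    simp only [hterm]
    rw [← Fintype.prod_sum fun (p : Fin d × Fin d) (a : Bool) =>
      if p ∈ C.image sortPair → a = decide (p ∈ C) then
            coin (pairwiseMatrix w p.1 p.2) (pairwiseMatrix_nonneg w _ _)
              (pairwiseMatrix_le_one w _ _) a else 0]
    have hfac : ∀ p : Fin d × Fin d, (∑ a : Bool,
        if p ∈ C.image sortPair → a = decide (p ∈ C) then
            coin (pairwiseMatrix w p.1 p.2) (pairwiseMatrix_nonneg w _ _)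
              (pairwiseMatrix_le_one w _ _) a else 0)
        = if p ∈ C.image sortPair then coin (pairwiseMatrix w p.1 p.2)
            (pairwiseMatrix_nonneg w _ _) (pairwiseMatrix_le_one w _ _) (decide (p ∈ C))
          else 1 := by
      intro p
      by_cases hp : p ∈ C.image sortPair
      · simp only [hp, true_imp_iff, if_true, Finset.sum_ite_eq', Finset.mem_univ]
      · simp only [hp, false_imp_iff, if_true, if_false]
        rw [← tsum_fintype (L := .unconditional _), PMF.tsum_coe]
    simp only [hfac, Finset.prod_ite_mem, Finset.univ_inter]
    rw [Finset.prod_image hC.sortPair_injOn,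
      ENNReal.ofReal_prod_of_nonneg fun p _ => pairwiseMatrix_nonneg w _ _]
    refine Finset.prod_congr rfl fun p hp => ?_
    rw [coin_apply]
    congr 1
    by_cases hlt : p.1 < p.2
    · simp [sortPair, hlt, hp]
    · simp only [sortPair, hlt, if_false, hC.swap_notMem hp, decide_false, Bool.false_eq_true]
      exact (pairwiseMatrix_swap w _ _).symm
  · simp [h]

/-- A uniformly random set of `m / 2` disjoint pairs of items. -/
def skeletonSample {d m : ℕ} (h : m ≤ d) : PMF (Finset (Fin d × Fin d)) :=
  PMF.uniformOfFinset (skeletons d (m / 2)) (skeletons_nonempty h)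

theorem mem_skeletons_of_skeletonSample_ne_zero {d m : ℕ} (h : m ≤ d)
    {U : Finset (Fin d × Fin d)} (hU : skeletonSample h U ≠ 0) : U ∈ skeletons d (m / 2) := by
  by_contra hn
  exact hU (by simp [skeletonSample, PMF.uniformOfFinset_apply, hn])

theorem skeletonSample_bind_apply {d m : ℕ} (h : m ≤ d) (w : Fin d → ℝ)
    (C : Finset (Fin d × Fin d)) :
    ((skeletonSample h).bind fun U => (outcomes w).map (orient U)) C
      = (#(skeletons d (m / 2)) : ℝ≥0∞)⁻¹ * matchingWeight (m / 2) w C := by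
  classical
  rw [PMF.bind_apply, tsum_fintype]
  simp only [skeletonSample, PMF.uniformOfFinset_apply, ite_mul, zero_mul]
  rw [← Finset.sum_filter, Finset.filter_mem_eq_inter, Finset.univ_inter, ← Finset.mul_sum]
  congr 1
  unfold matchingWeight
  by_cases hC : IsMatching C ∧ #C = m / 2
  · rw [if_pos hC, Finset.sum_eq_single (C.image sortPair)]
    · rw [outcomes_map_orient_apply w (fun p hp => ?_) hC.1, if_pos rfl]
      obtain ⟨p, hp', rfl⟩ := Finset.mem_image.mp hp
      exact hC.1.sortPair_lt hp'
    · intro U hU hne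
      rw [outcomes_map_orient_apply w (mem_skeletons.mp hU).2.2 hC.1, if_neg hne]
    · intro hn
      refine absurd ?_ hn
      have := hC.1.image_sortPair_mem_skeletons
      rwa [hC.2] at this
  · rw [if_neg hC]
    refine Finset.sum_eq_zero fun U hU => ?_
    rw [PMF.map_apply, tsum_fintype]
    refine Finset.sum_eq_zero fun b _ => if_neg ?_
    rintro rfl
    exact hC (isMatching_orient hU b)

theorem pmf_eq_of_proportional {α : Type} {p q : PMF α} {Z Z' : ℝ≥0∞} {f : α → ℝ≥0∞}
    (hp : ∀ x, p x = Z * f x) (hq : ∀ x, q x = Z' * f x) : p = q := by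
  have h1 : Z * ∑' x, f x = 1 := by
    rw [← ENNReal.tsum_mul_left, ← p.tsum_coe]
    exact tsum_congr fun x => (hp x).symm
  have h2 : Z' * ∑' x, f x = 1 := by
    rw [← ENNReal.tsum_mul_left, ← q.tsum_coe]
    exact tsum_congr fun x => (hq x).symm
  have h3 : Z = Z' :=
    (ENNReal.eq_inv_of_mul_eq_one_left h1).trans (ENNReal.eq_inv_of_mul_eq_one_left h2).symm
  ext x
  rw [hp, hq, h3]

/-- The comparisons obtained from one sample are those of a uniformly random set of disjoint pairs,
with independent outcomes. -/
theorem breakingSample_eq {d m : ℕ} (h : m ≤ d) (w : Fin d → ℝ) :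
    breakingSample h w = (skeletonSample h).bind fun U => (outcomes w).map (orient U) := by
  obtain ⟨Z, hZ⟩ := exists_breakingSample_apply h w
  exact pmf_eq_of_proportional hZ (skeletonSample_bind_apply h w)

/-! ### The probability that a pair is compared -/

/-- The probability that a given pair of items is compared in one sample, as a real number. -/
def pairProb (d m : ℕ) : ℝ := 2 * ((m / 2 : ℕ) : ℝ) / (d * (d - 1))

theorem matchingWeight_zero_map {d n : ℕ} (σ : Fin d ↪ Fin d) (C : Finset (Fin d × Fin d)) :
    matchingWeight n 0 (C.map (σ.prodMap σ)) = matchingWeight n 0 C := by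
  have h1 : (IsMatching (C.map (σ.prodMap σ)) ∧ #(C.map (σ.prodMap σ)) = n) ↔
      IsMatching C ∧ #C = n := by
    rw [isMatching_map, Finset.card_map]
  have h2 : ∏ p ∈ C.map (σ.prodMap σ), pairwiseMatrix (0 : Fin d → ℝ) p.1 p.2
      = ∏ p ∈ C, pairwiseMatrix (0 : Fin d → ℝ) p.1 p.2 := by
    simp [pairwiseMatrix]
  unfold matchingWeight
  rw [h2]
  split_ifs <;> tauto

theorem exists_perm_map_pair {α : Type} [DecidableEq α] {i j i' j' : α} (h : i ≠ j)
    (h' : i' ≠ j') : ∃ σ : Equiv.Perm α, σ i = i' ∧ σ j = j' := by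
  refine ⟨Equiv.swap (Equiv.swap i i' j) j' * Equiv.swap i i', ?_, ?_⟩
  · rw [Equiv.Perm.mul_apply, Equiv.swap_apply_left, Equiv.swap_apply_of_ne_of_ne _ h']
    intro h1
    have h2 := (Equiv.swap i i').injective ((Equiv.swap_apply_left i i').trans h1)
    exact h h2
  · rw [Equiv.Perm.mul_apply, Equiv.swap_apply_left]

theorem ex_breakingSample_zero_mem {d m : ℕ} (h : m ≤ d) {i j i' j' : Fin d} (hij : i ≠ j)
    (hij' : i' ≠ j') :
    ex (breakingSample h 0) (fun C => if (i, j) ∈ C then 1 else 0)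
      = ex (breakingSample h 0) (fun C => if (i', j') ∈ C then 1 else 0) := by
  obtain ⟨σ, rfl, rfl⟩ := exists_perm_map_pair hij hij'
  refine Fintype.sum_equiv (Equiv.prodCongr σ σ).finsetCongr _ _ fun C => ?_
  have h1 : (Equiv.prodCongr σ σ).finsetCongr C
      = C.map (σ.toEmbedding.prodMap σ.toEmbedding) := rfl
  have h2 : (σ i, σ j) ∈ C.map (σ.toEmbedding.prodMap σ.toEmbedding) ↔ (i, j) ∈ C :=
    Finset.mem_map' (σ.toEmbedding.prodMap σ.toEmbedding) (a := (i, j))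
  simp only [h1, h2]
  rw [breakingSample_eq, skeletonSample_bind_apply, skeletonSample_bind_apply,
    matchingWeight_zero_map]

theorem ex_breakingSample {d m : ℕ} (h : m ≤ d) (w : Fin d → ℝ)
    (f : Finset (Fin d × Fin d) → ℝ) :
    ex (breakingSample h w) f
      = ex (skeletonSample h) fun U => ex (outcomes w) fun b => f (orient U b) := by
  rw [breakingSample_eq, ex_bind]
  simp only [ex_map]

theorem ex_breakingSample_zero_mem_eq_half {d m : ℕ} (h : m ≤ d) {p : Fin d × Fin d}
    (hp : p.1 < p.2) :
    ex (breakingSample h 0) (fun C => if p ∈ C then 1 else 0)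
      = ex (skeletonSample h) (fun U => if p ∈ U then 1 else 0) / 2 := by
  rw [ex_breakingSample, div_eq_mul_inv, ← ex_mul_right]
  refine ex_congr_of_support _ fun U hU => ?_
  have hlt := (mem_skeletons.mp (mem_skeletons_of_skeletonSample_ne_zero h hU)).2.2
  simp only [mem_orient hlt _ hp]
  by_cases hpU : p ∈ U
  · simp only [hpU, true_and, if_true, one_mul]
    rw [outcomes, ex_indep_apply _ p (fun a => if a = true then (1 : ℝ) else 0), ex_coin]
    simp [pairwiseMatrix]
    norm_num
  · simp [hpU, ex_const]

theorem sum_offDiag_ex_breakingSample {d m : ℕ} (h : m ≤ d) (w : Fin d → ℝ) :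
    ∑ p ∈ (univ : Finset (Fin d)).offDiag,
      ex (breakingSample h w) (fun C => if p ∈ C then 1 else 0) = (m / 2 : ℕ) := by
  rw [← ex_sum, ← ex_const (breakingSample h w) ((m / 2 : ℕ) : ℝ), ex_breakingSample,
    ex_breakingSample]
  refine ex_congr_of_support _ fun U hU => congrArg _ (funext fun b => ?_)
  have hM := isMatching_orient (mem_skeletons_of_skeletonSample_ne_zero h hU) b
  rw [← Finset.sum_filter, Finset.sum_const, nsmul_eq_mul, mul_one, ← hM.2]
  congr 2
  ext p
  simp only [Finset.mem_filter, Finset.mem_offDiag, Finset.mem_univ, true_and]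
  exact ⟨fun h => h.2, fun hp => ⟨hM.1.1 p hp, hp⟩⟩

theorem ex_skeletonSample_mem {d m : ℕ} (h : m ≤ d) {p : Fin d × Fin d} (hp : p.1 < p.2) :
    ex (skeletonSample h) (fun U => if p ∈ U then 1 else 0) = pairProb d m := by
  have h1 := sum_offDiag_ex_breakingSample h (0 : Fin d → ℝ)
  have h2 : ∀ q ∈ (univ : Finset (Fin d)).offDiag,
      ex (breakingSample h 0) (fun C => if q ∈ C then 1 else 0)
        = ex (skeletonSample h) (fun U => if p ∈ U then 1 else 0) / 2 := by
    intro q hq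
    rw [← ex_breakingSample_zero_mem_eq_half h hp]
    exact ex_breakingSample_zero_mem h (Finset.mem_offDiag.mp hq).2.2 hp.ne
  rw [Finset.sum_congr rfl h2, Finset.sum_const, Finset.offDiag_card, Finset.card_univ,
    Fintype.card_fin, nsmul_eq_mul, Nat.cast_sub (Nat.le_mul_self d), Nat.cast_mul] at h1
  have hd : 2 ≤ d := by
    have := p.2.2
    have h3 : p.1.1 < p.2.1 := hp
    omega
  have hd' : (2 : ℝ) ≤ d := by exact_mod_cast hd
  have hne : (d : ℝ) * (d - 1) ≠ 0 := by
    have : (d : ℝ) - 1 ≠ 0 := by linarith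
    positivity
  rw [pairProb, eq_div_iff hne, ← h1]
  ring

/-! ### The outcome of the test, conditionally on the compared pairs -/

theorem ex_indep_breakingSample {d m : ℕ} (h : m ≤ d) (N : ℕ) (w : Fin d → ℝ)
    (f : (Fin N → Finset (Fin d × Fin d)) → ℝ) :
    ex (indep fun _ : Fin N => breakingSample h w) f
      = ex (indep fun _ : Fin N => skeletonSample h) fun U =>
          ex (indep fun _ : Fin N => outcomes w) fun b => f fun s => orient (U s) (b s) := by
  simp only [breakingSample_eq]
  rw [indep_bind (fun _ : Fin N => skeletonSample h) (fun _ U => (outcomes w).map (orient U)),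
    ex_bind]
  congr 1
  ext U
  rw [indep_map (fun _ : Fin N => outcomes w) (fun s => orient (U s)), ex_map]

theorem ex_testOutcome {d m : ℕ} (h : m ≤ d) (N : ℕ) (wP wQ : Fin d → ℝ) (f : Bool → ℝ) :
    ex (testOutcome h N wP wQ) f
      = ex (indep fun _ : Fin N => skeletonSample h) fun U =>
          ex (indep fun _ : Fin N => skeletonSample h) fun V =>
            ex (indep fun _ : Fin N => outcomes wP) fun b =>
              ex (indep fun _ : Fin N => outcomes wQ) fun c =>
                f (open Classical in decide (11 * (d : ℝ) ≤ testStatistic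
                  (fun s => orient (U s) (b s)) (fun s => orient (V s) (c s)))) := by
  have h1 : ex (testOutcome h N wP wQ) f
      = ex (indep fun _ : Fin N => breakingSample h wP) fun CP =>
          ex (indep fun _ : Fin N => breakingSample h wQ) fun CQ =>
            f (open Classical in decide (11 * (d : ℝ) ≤ testStatistic CP CQ)) := by
    unfold breakingSample
    rw [indep_bind (fun _ : Fin N => rankingSample h wP) (fun _ => randomDisjoint),
      indep_bind (fun _ : Fin N => rankingSample h wQ) (fun _ => randomDisjoint)]
    simp only [testOutcome, algorithm, ex_bind, ex_map]
    congr 1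
    ext SP
    rw [ex_comm]
  rw [h1, ex_indep_breakingSample]
  congr 1
  ext U
  simp only [ex_indep_breakingSample]
  rw [ex_comm]

/-- The increasing pairs of items. -/
def incPairs (d : ℕ) : Finset (Fin d × Fin d) := {p | p.1 < p.2}

theorem mem_incPairs {d : ℕ} {p : Fin d × Fin d} : p ∈ incPairs d ↔ p.1 < p.2 := by
  simp [incPairs]

theorem card_incPairs_le (d : ℕ) : (#(incPairs d) : ℝ) ≤ (d : ℝ) ^ 2 := by
  have h := Finset.card_le_univ (incPairs d)
  rw [Fintype.card_prod, Fintype.card_fin, ← sq] at h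
  exact_mod_cast h

theorem sum_incPairs {d : ℕ} (f : Fin d × Fin d → ℝ) :
    ∑ p ∈ incPairs d, f p = ∑ i : Fin d, ∑ j ∈ Finset.Ioi i, f (i, j) := by
  rw [incPairs, Finset.sum_filter, Fintype.sum_prod_type]
  refine Finset.sum_congr rfl fun i _ => ?_
  rw [← Finset.sum_filter]
  refine Finset.sum_congr ?_ fun _ _ => rfl
  ext j
  simp

theorem sum_eq_two_mul_sum_incPairs {d : ℕ} (f : Fin d × Fin d → ℝ) (hf : ∀ p, f p.swap = f p)
    (hd : ∀ i, f (i, i) = 0) : ∑ p, f p = 2 * ∑ p ∈ incPairs d, f p := by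
  have h1 : ∀ p : Fin d × Fin d,
      f p = (if p.1 < p.2 then f p else 0) + if p.2 < p.1 then f p else 0 := by
    intro p
    rcases lt_trichotomy p.1 p.2 with h | h | h
    · simp [h, h.not_gt]
    · obtain ⟨i, j⟩ := p
      obtain rfl : i = j := h
      simp [hd]
    · simp [h, h.not_gt]
  have h2 : ∑ p : Fin d × Fin d, (if p.2 < p.1 then f p else 0)
      = ∑ p : Fin d × Fin d, if p.1 < p.2 then f p else 0 :=
    Fintype.sum_equiv (Equiv.prodComm _ _) _ _ fun p => by
      simp only [Equiv.prodComm_apply, Prod.fst_swap, Prod.snd_swap, hf]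
  rw [Finset.sum_congr rfl fun p _ => h1 p, Finset.sum_add_distrib, h2, ← Finset.sum_filter,
    incPairs]
  ring

/-- The number of sets in `U` that contain the pair `p`. -/
def pairCount {d N : ℕ} (U : Fin N → Finset (Fin d × Fin d)) (p : Fin d × Fin d) : ℕ :=
  #{s | p ∈ U s}

theorem testStatistic_orient {d N n : ℕ} {U V : Fin N → Finset (Fin d × Fin d)}
    (hU : ∀ s, U s ∈ skeletons d n) (hV : ∀ s, V s ∈ skeletons d n)
    (b c : Fin N → Fin d × Fin d → Bool) :
    testStatistic (fun s => orient (U s) (b s)) (fun s => orient (V s) (c s))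
      = ∑ p ∈ incPairs d, statTerm (pairCount U p) (pairCount V p)
          #{s | p ∈ U s ∧ b s p = true} #{s | p ∈ V s ∧ c s p = true} := by
  have hw : ∀ {U : Fin N → Finset (Fin d × Fin d)} (_ : ∀ s, U s ∈ skeletons d n)
      (b : Fin N → Fin d × Fin d → Bool) (i j : Fin d), i < j →
      wins (fun s => orient (U s) (b s)) i j = #{s | (i, j) ∈ U s ∧ b s (i, j) = true} := by
    intro U hU b i j hij
    unfold wins
    congr 1
    ext s
    simp only [Finset.mem_filter, Finset.mem_univ, true_and]
    exact mem_orient (mem_skeletons.mp (hU s)).2.2 (b s) (p := (i, j)) hij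
  have hk : ∀ {U : Fin N → Finset (Fin d × Fin d)} (_ : ∀ s, U s ∈ skeletons d n)
      (b : Fin N → Fin d × Fin d → Bool) (i j : Fin d), i < j →
      comparisons (fun s => orient (U s) (b s)) i j = pairCount U (i, j) := by
    intro U hU b i j hij
    unfold comparisons pairCount
    congr 1
    ext s
    simp only [Finset.mem_filter, Finset.mem_univ, true_and]
    have h1 := mem_orient (mem_skeletons.mp (hU s)).2.2 (b s) (p := (i, j)) hij
    have h2 := swap_mem_orient (mem_skeletons.mp (hU s)).2.2 (b s) (p := (i, j)) hij
    rw [Prod.swap_prod_mk] at h2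
    rw [h1, h2]
    cases b s (i, j) <;> simp
  rw [testStatistic, sum_incPairs]
  refine Finset.sum_congr rfl fun i _ => Finset.sum_congr rfl fun j hj => ?_
  have hij := Finset.mem_Ioi.mp hj
  rw [hw hU b i j hij, hw hV c i j hij, hk hU b i j hij, hk hV c i j hij]

/-- The conditional mean of the statistic, given the compared pairs. -/
def statMean {d N : ℕ} (U V : Fin N → Finset (Fin d × Fin d)) (wP wQ : Fin d → ℝ) : ℝ :=
  ∑ p ∈ incPairs d, termMean (pairCount U p) (pairCount V p)
    (pairwiseMatrix wP p.1 p.2) (pairwiseMatrix wQ p.1 p.2)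

/-- The conditional variance of the statistic, given the compared pairs. -/
theorem ex_testStatistic_sub_sq_le {d N n : ℕ} {U V : Fin N → Finset (Fin d × Fin d)}
    (hU : ∀ s, U s ∈ skeletons d n) (hV : ∀ s, V s ∈ skeletons d n) (wP wQ : Fin d → ℝ) :
    (ex (indep fun _ : Fin N => outcomes wP) fun b =>
        ex (indep fun _ : Fin N => outcomes wQ) fun c =>
          (testStatistic (fun s => orient (U s) (b s)) (fun s => orient (V s) (c s))
            - statMean U V wP wQ) ^ 2)
      ≤ (d : ℝ) ^ 2 / 4 + statMean U V wP wQ := by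
  let B : (Fin d → ℝ) → Fin d × Fin d → PMF (Fin N → Bool) := fun w p => indep fun _ =>
    coin (pairwiseMatrix w p.1 p.2) (pairwiseMatrix_nonneg w _ _) (pairwiseMatrix_le_one w _ _)
  let g : Fin d × Fin d → (Fin N → Bool) × (Fin N → Bool) → ℝ := fun p x =>
    statTerm (pairCount U p) (pairCount V p) #{s | p ∈ U s ∧ x.1 s = true}
      #{s | p ∈ V s ∧ x.2 s = true}
    - termMean (pairCount U p) (pairCount V p) (pairwiseMatrix wP p.1 p.2)
        (pairwiseMatrix wQ p.1 p.2)
  have hB : ∀ (p : Fin d × Fin d) (F : ℕ → ℕ → ℝ),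
      ex ((B wP p).bind fun x => (B wQ p).map (Prod.mk x))
        (fun x => F #{s | p ∈ U s ∧ x.1 s = true} #{s | p ∈ V s ∧ x.2 s = true})
      = binomialEx (pairwiseMatrix wP p.1 p.2) (pairCount U p) fun x =>
          binomialEx (pairwiseMatrix wQ p.1 p.2) (pairCount V p) fun y => F x y := by
    intro p F
    simp only [ex_bind, ex_map]
    have h1 : ∀ x : Fin N → Bool, ex (B wQ p) (fun y =>
        F #{s | p ∈ U s ∧ x s = true} #{s | p ∈ V s ∧ y s = true})
        = binomialEx (pairwiseMatrix wQ p.1 p.2) (pairCount V p)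
            (F #{s | p ∈ U s ∧ x s = true}) := fun x =>
      ex_indep_coin _ _ _ (fun s => p ∈ V s) _
    simp only [h1]
    exact ex_indep_coin _ _ _ (fun s => p ∈ U s) fun k =>
      binomialEx (pairwiseMatrix wQ p.1 p.2) (pairCount V p) (F k)
  have hg : ∀ p ∈ incPairs d,
      ex ((B wP p).bind fun x => (B wQ p).map (Prod.mk x)) (g p) = 0 := by
    intro p _
    rw [ex_sub, ex_const, hB p (statTerm (pairCount U p) (pairCount V p)), binomialEx_statTerm,
      sub_self]
  have key := ex_indep_sq_sum _ (incPairs d) g hg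
  rw [ex_indep_prodMk (B wP) (B wQ) (fun x => (∑ p ∈ incPairs d, g p (x p)) ^ 2)] at key
  have hswap : (ex (indep fun _ : Fin N => outcomes wP) fun b =>
        ex (indep fun _ : Fin N => outcomes wQ) fun c =>
          (testStatistic (fun s => orient (U s) (b s)) (fun s => orient (V s) (c s))
            - statMean U V wP wQ) ^ 2)
      = ex (indep (B wP)) fun y => ex (indep (B wQ)) fun z =>
          (∑ p ∈ incPairs d, g p (y p, z p)) ^ 2 := by
    unfold outcomes
    rw [ex_indep_indep]
    congr 1
    ext y
    rw [ex_indep_indep]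
    congr 1
    ext z
    rw [testStatistic_orient hU hV, statMean, ← Finset.sum_sub_distrib]
  rw [hswap, key]
  calc ∑ p ∈ incPairs d, ex ((B wP p).bind fun x => (B wQ p).map (Prod.mk x))
        (fun a => g p a ^ 2)
      ≤ ∑ p ∈ incPairs d, (1 / 4 + termMean (pairCount U p) (pairCount V p)
          (pairwiseMatrix wP p.1 p.2) (pairwiseMatrix wQ p.1 p.2)) := by
        refine Finset.sum_le_sum fun p _ => ?_
        rw [hB p fun x y => (statTerm (pairCount U p) (pairCount V p) x y
          - termMean (pairCount U p) (pairCount V p) (pairwiseMatrix wP p.1 p.2)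
              (pairwiseMatrix wQ p.1 p.2)) ^ 2]
        exact binomialEx_statTerm_sub_sq_le _ _ (pairwiseMatrix_nonneg _ _ _)
          (pairwiseMatrix_le_one _ _ _) (pairwiseMatrix_nonneg _ _ _)
          (pairwiseMatrix_le_one _ _ _)
    _ ≤ (d : ℝ) ^ 2 / 4 + statMean U V wP wQ := by
        rw [Finset.sum_add_distrib, Finset.sum_const, nsmul_eq_mul, statMean]
        have := card_incPairs_le d
        linarith

theorem skeletons_of_indep_ne_zero {d m N : ℕ} (h : m ≤ d) {U : Fin N → Finset (Fin d × Fin d)}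
    (hU : (indep fun _ : Fin N => skeletonSample h) U ≠ 0) (s : Fin N) :
    U s ∈ skeletons d (m / 2) := by
  rw [indep_apply] at hU
  exact mem_skeletons_of_skeletonSample_ne_zero h
    (Finset.prod_ne_zero_iff.mp hU s (Finset.mem_univ s))

/-- Chebyshev's inequality for the statistic, conditionally on the compared pairs. -/
theorem ex_outcome_le {d N n : ℕ} {U V : Fin N → Finset (Fin d × Fin d)}
    (hU : ∀ s, U s ∈ skeletons d n) (hV : ∀ s, V s ∈ skeletons d n) (wP wQ : Fin d → ℝ)
    (r : Bool) {t : ℝ} (ht : 0 < t)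
    (hr : ∀ x : ℝ, (open Classical in decide (11 * (d : ℝ) ≤ x)) = r →
      t ≤ |x - statMean U V wP wQ|) :
    (ex (indep fun _ : Fin N => outcomes wP) fun b =>
        ex (indep fun _ : Fin N => outcomes wQ) fun c =>
          if (open Classical in decide (11 * (d : ℝ) ≤ testStatistic
            (fun s => orient (U s) (b s)) (fun s => orient (V s) (c s)))) = r then 1 else 0)
      ≤ ((d : ℝ) ^ 2 / 4 + statMean U V wP wQ) / t ^ 2 := by
  refine le_trans ?_ (div_le_div_of_nonneg_right (ex_testStatistic_sub_sq_le hU hV wP wQ)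
    (sq_nonneg t))
  simp only [div_eq_mul_inv, ← ex_mul_right]
  refine ex_mono _ fun b => ex_mono _ fun c => ?_
  split_ifs with hx
  · have h1 := hr _ hx
    rw [← div_eq_mul_inv, one_le_div (by positivity), ← sq_abs (_ - _)]
    gcongr
  · positivity

/-! ### Concentration of the numbers of comparisons -/

theorem ex_pairCount_lt_le {d m : ℕ} (h : m ≤ d) (N : ℕ) {p : Fin d × Fin d} (hp : p.1 < p.2)
    (hpos : 0 < N * pairProb d m) :
    ex (indep fun _ : Fin N => skeletonSample h)
        (fun U => if (pairCount U p : ℝ) < N * pairProb d m / 2 then 1 else 0)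
      ≤ 4 / (N * pairProb d m) := by
  set g : Finset (Fin d × Fin d) → ℝ := fun U => (if p ∈ U then 1 else 0) - pairProb d m with hg
  have hmean : ex (skeletonSample h) g = 0 := by
    rw [hg, ex_sub, ex_const, ex_skeletonSample_mem h hp, sub_self]
  have hvar : ex (skeletonSample h) (fun U => g U ^ 2) ≤ pairProb d m := by
    have h1 : (fun U => g U ^ 2) = fun U => (1 - 2 * pairProb d m) * (if p ∈ U then 1 else 0)
        + pairProb d m ^ 2 := by
      ext U
      simp only [hg]
      split_ifs <;> ring
    rw [h1, ex_add, ex_mul_left, ex_const, ex_skeletonSample_mem h hp]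
    nlinarith [sq_nonneg (pairProb d m)]
  have hsum : ∀ U : Fin N → Finset (Fin d × Fin d),
      (pairCount U p : ℝ) - N * pairProb d m = ∑ s, g (U s) := by
    intro U
    simp only [hg, Finset.sum_sub_distrib, Finset.sum_boole, Finset.sum_const, Finset.card_univ,
      Fintype.card_fin, nsmul_eq_mul, pairCount]
  have hsq := ex_indep_sq_sum (fun _ : Fin N => skeletonSample h) univ (fun _ => g)
    fun _ _ => hmean
  calc _ ≤ ex (indep fun _ : Fin N => skeletonSample h) (fun U =>
          if N * pairProb d m / 2 ≤ |∑ s, g (U s)| then 1 else 0) := by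
        refine ex_mono _ fun U => ?_
        rw [← hsum]
        split_ifs with h1 h2
        · exact le_rfl
        · refine absurd (le_trans ?_ (neg_le_abs _)) h2
          linarith
        · exact zero_le_one
        · exact le_rfl
    _ ≤ _ := ex_chebyshev _ _ (by linarith)
    _ ≤ N * pairProb d m / (N * pairProb d m / 2) ^ 2 := by
        rw [hsq, Finset.sum_const, Finset.card_univ, Fintype.card_fin, nsmul_eq_mul]
        gcongr
    _ = 4 / (N * pairProb d m) := by
        field_simp
        norm_num

/-! ### The two types of errors -/

theorem testOutcome_apply_eq {d m : ℕ} (h : m ≤ d) (N : ℕ) (wP wQ : Fin d → ℝ) (r : Bool) :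
    testOutcome h N wP wQ r
      = ENNReal.ofReal (ex (testOutcome h N wP wQ) fun x => if x = r then 1 else 0) := by
  rw [← ENNReal.ofReal_toReal ((testOutcome h N wP wQ).apply_ne_top r)]
  simp [ex]

/-- The squared distance of the two pairwise probability matrices on the increasing pairs. -/
def pairGap {d : ℕ} (wP wQ : Fin d → ℝ) : ℝ :=
  ∑ p ∈ incPairs d, (pairwiseMatrix wP p.1 p.2 - pairwiseMatrix wQ p.1 p.2) ^ 2

theorem sq_norm_sub_eq_two_mul_pairGap {d : ℕ} (wP wQ : Fin d → ℝ) :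
    ‖pairwiseMatrix wP - pairwiseMatrix wQ‖ ^ 2 = 2 * pairGap wP wQ := by
  rw [pairGap, ← sum_eq_two_mul_sum_incPairs (fun p : Fin d × Fin d =>
    (pairwiseMatrix wP p.1 p.2 - pairwiseMatrix wQ p.1 p.2) ^ 2), Fintype.sum_prod_type,
    Matrix.frobenius_norm_def, ← Real.sqrt_eq_rpow, Real.sq_sqrt (by positivity)]
  · simp
  · intro p
    simp only [Prod.fst_swap, Prod.snd_swap]
    rw [pairwiseMatrix_swap wP p.1, pairwiseMatrix_swap wQ p.1]
    ring
  · intro i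
    have h : ∀ w : Fin d → ℝ, pairwiseMatrix w i i = 1 / 2 := by
      intro w
      have := pairwiseMatrix_swap w i i
      linarith
    rw [h, h]
    norm_num

theorem testOutcome_true_le {d m : ℕ} (h : m ≤ d) (hd : 0 < d) (N : ℕ) {wP wQ : Fin d → ℝ}
    (hPQ : pairwiseMatrix wP = pairwiseMatrix wQ) :
    testOutcome h N wP wQ true ≤ ENNReal.ofReal (1 / 100) := by
  have hd' : (0 : ℝ) < d := by exact_mod_cast hd
  rw [testOutcome_apply_eq]
  refine ENNReal.ofReal_le_ofReal ?_
  rw [ex_testOutcome, ← ex_const (indep fun _ : Fin N => skeletonSample h) (1 / 100)]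
  refine ex_mono_of_support _ fun U hU => ?_
  rw [← ex_const (indep fun _ : Fin N => skeletonSample h) (1 / 100)]
  refine ex_mono_of_support _ fun V hV => ?_
  have hmean : statMean U V wP wQ = 0 :=
    Finset.sum_eq_zero fun p _ => by simp [termMean, hPQ]
  refine (ex_outcome_le (skeletons_of_indep_ne_zero h hU) (skeletons_of_indep_ne_zero h hV)
    wP wQ true (t := 11 * d) (by positivity) fun x hx => ?_).trans ?_
  · rw [hmean, sub_zero]
    exact (of_decide_eq_true hx).trans (le_abs_self x)
  · rw [hmean, add_zero, div_le_iff₀ (by positivity)]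
    nlinarith

theorem mul_div_add_ge_half {K k l : ℝ} (hK : 0 < K) (hk : K ≤ k) (hl : K ≤ l) :
    K / 2 ≤ k * l / (k + l) := by
  rw [div_le_div_iff₀ two_pos (by linarith)]
  nlinarith [mul_nonneg (sub_nonneg.mpr hk) (hK.le.trans hl),
    mul_nonneg (sub_nonneg.mpr hl) (hK.le.trans hk)]

/-- The part of `pairGap` that is due to pairs with fewer than `K` comparisons. -/
def rareGap {d N : ℕ} (K : ℝ) (U V : Fin N → Finset (Fin d × Fin d)) (wP wQ : Fin d → ℝ) : ℝ :=
  ∑ p ∈ incPairs d, (pairwiseMatrix wP p.1 p.2 - pairwiseMatrix wQ p.1 p.2) ^ 2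
    * ((if (pairCount U p : ℝ) < K then 1 else 0) + if (pairCount V p : ℝ) < K then 1 else 0)

theorem rareGap_nonneg {d N : ℕ} (K : ℝ) (U V : Fin N → Finset (Fin d × Fin d))
    (wP wQ : Fin d → ℝ) : 0 ≤ rareGap K U V wP wQ := by
  refine Finset.sum_nonneg fun p _ => mul_nonneg (sq_nonneg _) (add_nonneg ?_ ?_) <;>
    split_ifs <;> norm_num

theorem le_statMean {d N : ℕ} {K : ℝ} (hK : 1 < K) (U V : Fin N → Finset (Fin d × Fin d))
    (wP wQ : Fin d → ℝ) :
    K / 2 * (pairGap wP wQ - rareGap K U V wP wQ) ≤ statMean U V wP wQ := by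
  rw [pairGap, rareGap, ← Finset.sum_sub_distrib, Finset.mul_sum, statMean]
  refine Finset.sum_le_sum fun p _ => ?_
  set D := (pairwiseMatrix wP p.1 p.2 - pairwiseMatrix wQ p.1 p.2) ^ 2 with hD
  have hD0 : 0 ≤ D := sq_nonneg _
  have h0 := termMean_nonneg (pairCount U p) (pairCount V p) (pairwiseMatrix wP p.1 p.2)
    (pairwiseMatrix wQ p.1 p.2)
  have hKD : 0 ≤ K / 2 * D := by positivity
  by_cases hU : (pairCount U p : ℝ) < K
  · rw [if_pos hU]
    split_ifs <;> nlinarith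
  · by_cases hV : (pairCount V p : ℝ) < K
    · rw [if_neg hU, if_pos hV]
      nlinarith
    · rw [if_neg hU, if_neg hV, termMean, if_pos]
      · have h1 := mul_div_add_ge_half (by linarith) (not_lt.mp hU) (not_lt.mp hV)
        have h2 := mul_le_mul_of_nonneg_right h1 hD0
        linarith
      · constructor
        · exact_mod_cast hK.trans_le (not_lt.mp hU)
        · exact_mod_cast hK.trans_le (not_lt.mp hV)

theorem ex_rareGap_le {d m : ℕ} (h : m ≤ d) (N : ℕ) (hpos : 0 < N * pairProb d m)
    (wP wQ : Fin d → ℝ) :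
    (ex (indep fun _ : Fin N => skeletonSample h) fun U =>
      ex (indep fun _ : Fin N => skeletonSample h) fun V =>
        rareGap (N * pairProb d m / 2) U V wP wQ)
      ≤ pairGap wP wQ * (8 / (N * pairProb d m)) := by
  simp only [rareGap, ex_sum, ex_mul_left, ex_add, ex_const]
  rw [pairGap, Finset.sum_mul]
  refine Finset.sum_le_sum fun p hp => mul_le_mul_of_nonneg_left ?_ (sq_nonneg _)
  have h1 := ex_pairCount_lt_le h N (mem_incPairs.mp hp) hpos
  calc _ ≤ 4 / (N * pairProb d m) + 4 / (N * pairProb d m) := add_le_add h1 h1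
    _ = 8 / (N * pairProb d m) := by ring

theorem testOutcome_false_le {d m : ℕ} (h : m ≤ d) (hd : 3 ≤ d) {N : ℕ} {wP wQ : Fin d → ℝ}
    (hN : 400 ≤ N * pairProb d m) (hgap : 176 * (d : ℝ) ≤ N * pairProb d m * pairGap wP wQ) :
    testOutcome h N wP wQ false ≤ ENNReal.ofReal (1 / 5) := by
  have hd' : (3 : ℝ) ≤ d := by exact_mod_cast hd
  set lam : ℝ := N * pairProb d m with hlam
  set W := pairGap wP wQ with hW
  have hlam0 : 0 < lam := by linarith
  have hW0 : 0 < W := by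
    by_contra hn
    have : lam * W ≤ 0 := mul_nonpos_of_nonneg_of_nonpos hlam0.le (not_lt.mp hn)
    linarith
  have hcond : ∀ U V : Fin N → Finset (Fin d × Fin d), (∀ s, U s ∈ skeletons d (m / 2)) →
      (∀ s, V s ∈ skeletons d (m / 2)) → rareGap (lam / 2) U V wP wQ < W / 2 →
      (ex (indep fun _ : Fin N => outcomes wP) fun b =>
        ex (indep fun _ : Fin N => outcomes wQ) fun c =>
          if (open Classical in decide (11 * (d : ℝ) ≤ testStatistic
            (fun s => orient (U s) (b s)) (fun s => orient (V s) (c s)))) = false then 1 else 0)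
        ≤ (1 : ℝ) / 10 := by
    intro U V hU hV hG
    set M := statMean U V wP wQ with hM
    have h1 : 22 * (d : ℝ) ≤ M := by
      have h2 := le_statMean (K := lam / 2) (by linarith) U V wP wQ
      have h3 : lam / 2 / 2 * (W / 2) ≤ lam / 2 / 2 * (W - rareGap (lam / 2) U V wP wQ) :=
        mul_le_mul_of_nonneg_left (by linarith) (by linarith)
      linarith
    have hM0 : 0 < M := by linarith
    refine (ex_outcome_le hU hV wP wQ false (t := M / 2) (by linarith) fun x hx => ?_).trans ?_
    · have h2 := not_le.mp (of_decide_eq_false hx)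
      refine le_trans ?_ (neg_le_abs _)
      linarith
    · rw [div_le_iff₀ (by positivity)]
      nlinarith
  have hbound : (ex (testOutcome h N wP wQ) fun x => if x = false then (1 : ℝ) else 0)
      ≤ (ex (indep fun _ : Fin N => skeletonSample h) fun U =>
          ex (indep fun _ : Fin N => skeletonSample h) fun V =>
            rareGap (lam / 2) U V wP wQ * (2 / W)) + 1 / 10 := by
    rw [ex_testOutcome, ← ex_const (indep fun _ : Fin N => skeletonSample h) (1 / 10), ← ex_add]
    refine ex_mono_of_support _ fun U hU => ?_
    rw [← ex_const (indep fun _ : Fin N => skeletonSample h) (1 / 10), ← ex_add]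
    refine ex_mono_of_support _ fun V hV => ?_
    have hG0 := rareGap_nonneg (lam / 2) U V wP wQ
    by_cases hG : rareGap (lam / 2) U V wP wQ < W / 2
    · have h1 := hcond U V (skeletons_of_indep_ne_zero h hU) (skeletons_of_indep_ne_zero h hV) hG
      have h2 : 0 ≤ rareGap (lam / 2) U V wP wQ * (2 / W) := by positivity
      linarith
    · have h1 : 1 ≤ rareGap (lam / 2) U V wP wQ * (2 / W) := by
        rw [mul_div_assoc', one_le_div hW0]
        linarith
      refine le_trans (b := 1) ?_ (by linarith)
      refine le_of_le_of_eq (b := ex (indep fun _ : Fin N => outcomes wP) fun _ =>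
        ex (indep fun _ : Fin N => outcomes wQ) fun _ => 1) ?_ (by simp only [ex_const])
      refine ex_mono _ fun b => ex_mono _ fun c => ?_
      split_ifs <;> norm_num
  rw [testOutcome_apply_eq]
  refine ENNReal.ofReal_le_ofReal (hbound.trans ?_)
  simp only [ex_mul_right]
  have h1 := mul_le_mul_of_nonneg_right (ex_rareGap_le h N hlam0 wP wQ)
    (by positivity : 0 ≤ 2 / W)
  rw [← hlam, ← hW] at h1
  have h2 : W * (8 / lam) * (2 / W) = 16 / lam := by
    field_simp
    norm_num
  have h3 : 16 / lam ≤ 16 / 400 := by gcongr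
  linarith

theorem pairProb_ge {d m : ℕ} (hm : 2 ≤ m) (hmd : m < d) :
    2 / 3 * (m : ℝ) / (d : ℝ) ^ 2 ≤ pairProb d m := by
  have hd : (3 : ℝ) ≤ d := by
    have : 3 ≤ d := by omega
    exact_mod_cast this
  have h1 : (m : ℝ) ≤ 3 * ((m / 2 : ℕ) : ℝ) := by
    have : m ≤ 3 * (m / 2) := by omega
    exact_mod_cast this
  rw [pairProb]
  refine div_le_div₀ (by positivity) (by linarith) (mul_pos (by linarith) (by linarith)) ?_
  nlinarith

/-- The sample size condition bounds the expected number of comparisons of a pair from below. -/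
theorem sampleSize_mul_pairProb_ge {d m N : ℕ} (hm : 2 ≤ m) (hmd : m < d) {x : ℝ} (hx : 0 ≤ x)
    (hN : 600 * ((d : ℝ) ^ 2 * Real.log d / m) * x ≤ N) : 400 * x ≤ N * pairProb d m := by
  have hd : (3 : ℝ) ≤ d := by
    have : 3 ≤ d := by omega
    exact_mod_cast this
  have hm' : (0 : ℝ) < m := by
    have : 0 < m := by omega
    exact_mod_cast this
  have hlog : 1 ≤ Real.log d := by
    rw [Real.le_log_iff_exp_le (by linarith)]
    exact Real.exp_one_lt_d9.le.trans (by linarith)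
  calc 400 * x ≤ 400 * x * Real.log d := le_mul_of_one_le_right (by positivity) hlog
    _ = 600 * ((d : ℝ) ^ 2 * Real.log d / m) * x * (2 / 3 * (m : ℝ) / (d : ℝ) ^ 2) := by
        field_simp
        ring
    _ ≤ N * pairProb d m :=
        mul_le_mul hN (pairProb_ge hm hmd) (by positivity) (Nat.cast_nonneg N)

end

end RankTest

theorem theorem5 :
    ∃ c₀ : ℝ, 0 < c₀ ∧ ∀ c₁ : ℝ, 0 < c₁ → ∀ c₂ : ℝ, 0 < c₂ → ∃ c : ℝ, 0 < c ∧
      ∀ (d m N : ℕ) (_ : 2 ≤ m) (hmd : m < d) (ε : ℝ),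
        c₁ * (d : ℝ) ^ (-c₂) ≤ ε →
        c * ((d : ℝ) ^ 2 * Real.log d / m) * (⌈c₀ / (d * ε ^ 2)⌉₊ : ℝ) ≤ N →
        RankTest.typeIError hmd.le N + RankTest.typeIIError hmd.le N ε ≤ 1 / 3 := by
  refine ⟨1, one_pos, fun c₁ hc₁ c₂ _ => ⟨600, by norm_num, fun d m N hm hmd ε hε hN => ?_⟩⟩
  have hd : 3 ≤ d := by omega
  have hd' : (0 : ℝ) < d := by
    have : 0 < d := by omega
    exact_mod_cast this
  have hε0 : 0 < ε := lt_of_lt_of_le (by positivity) hε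
  have hceil : (1 : ℝ) ≤ (⌈1 / (d * ε ^ 2)⌉₊ : ℝ) := by
    have : 0 < ⌈1 / (d * ε ^ 2)⌉₊ := Nat.ceil_pos.mpr (by positivity)
    exact_mod_cast this
  have hlam := RankTest.sampleSize_mul_pairProb_ge hm hmd (Nat.cast_nonneg _) hN
  have h1 : RankTest.typeIError hmd.le N ≤ ENNReal.ofReal (1 / 100) :=
    iSup_le fun wP => iSup_le fun wQ => iSup_le fun hPQ =>
      RankTest.testOutcome_true_le hmd.le (by omega) N hPQ
  have h2 : RankTest.typeIIError hmd.le N ε ≤ ENNReal.ofReal (1 / 5) := by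
    refine iSup_le fun wP => iSup_le fun wQ => iSup_le fun hPQ =>
      RankTest.testOutcome_false_le hmd.le hd (by linarith) ?_
    have hgap : (d : ℝ) ^ 2 * ε ^ 2 ≤ 2 * RankTest.pairGap wP wQ := by
      rw [← RankTest.sq_norm_sub_eq_two_mul_pairGap, ← mul_pow]
      rw [one_div, ← div_eq_inv_mul, le_div_iff₀' hd'] at hPQ
      gcongr
    have h3 : 400 * (1 / (d * ε ^ 2)) ≤ N * RankTest.pairProb d m :=
      (mul_le_mul_of_nonneg_left (Nat.le_ceil _) (by norm_num)).trans hlam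
    have h4 := mul_le_mul h3 hgap (by positivity) (le_trans (by positivity) h3)
    have h5 : 400 * (1 / (d * ε ^ 2)) * ((d : ℝ) ^ 2 * ε ^ 2) = 400 * d := by
      field_simp
    linarith
  refine (add_le_add h1 h2).trans ?_
  rw [← ENNReal.ofReal_add (by norm_num) (by norm_num), ENNReal.ofReal_le_iff_le_toReal (by simp)]
  simp only [ENNReal.toReal_div, ENNReal.toReal_one, ENNReal.toReal_ofNat]
  norm_num
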